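/- Let $l,m\ge 1$, $r\ge 1$, let $\mathcal{M}_{l,m}$ be the space of real $l\times m$ matrices with the Frobenius scalar product $\langle A,B\rangle=\mathrm{Tr}(A^TB)$ and norm $\|A\|=\langle A,A\rangle^{1/2}$, and let $\mathscr{M}=\{R\in\mathcal{M}_{l,m} : \mathrm{rank}(R)=r\}$. For a matrix $\mathfrak{R}$ such that exactly one point of $\mathscr{M}$ minimizes the distance $R\mapsto\|\mathfrak{R}-R\|$ over $R\in\mathscr{M}$, let $\Pi_{\mathscr{M}}(\mathfrak{R})$ be this point. For $R\in\mathscr{M}$ let $\mathcal{T}(R)$ be the tangent space of $\mathscr{M}$ at $R$, i.e. the set of velocities $\dot\gamma(0)$ of smooth curves $\gamma$ drawn on $\mathscr{M}$ with $\gamma(0)=R$, and let $\Pi_{\mathcal{T}(R)}$ be the orthogonal projection of $\mathcal{M}_{l,m}$ onto $\mathcal{T}(R)$. Let $\mathfrak{R}\in\mathcal{M}_{l,m}$ have rank $r+k$ with $k\ge 1$, and let $\mathfrak{R}=\sum_{i=1}^{r+k}\sigma_i u_iv_i^T$ be a singular value decomposition, with $\sigma_1\ge\sigma_2\ge\dots\ge\sigma_{r+k}>0$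 and orthonormal families $(u_i)$ in $\mathbb{R}^l$ and $(v_i)$ in $\mathbb{R}^m$. Suppose that $\sigma_r>\sigma_{r+1}$ (no other singular values need be distinct). Then: 1. For all matrices $B$ in a neighbourhood of $\mathfrak{R}$ the projection $\Pi_{\mathscr{M}}(B)$ is uniquely defined and is the rank-$r$ truncated SVD of $B$ (the sum of the first $r$ terms of any SVD of $B$ with decreasingly ordered singular values). 2. $\Pi_{\mathscr{M}}$ is differentiable at $\mathfrak{R}$, and for every direction $\mathfrak{X}\in\mathcal{M}_{l,m}$ $$\mathrm{D}_{\mathfrak{X}}\Pi_{\mathscr{M}}(\mathfrak{R})=\Pi_{\mathcal{T}(\Pi_{\mathscr{M}}(\mathfrak{R}))}(\mathfrak{X})+\sum_{\substack{1\le i\le r\\1\le j\le k}}\left[\frac{\sigma_{r+j}}{\sigma_i-\sigma_{r+j}}\langle\mathfrak{X},\Phi^+_{i,r+j}\rangle\Phi^+_{i,r+j}-\frac{\sigma_{r+j}}{\sigma_i+\sigma_{r+j}}\langle\mathfrak{X},\Phi^-_{i,r+j}\rangle\Phi^-_{i,r+j}\right],$$ where $\Phi^{\pm}_{i,r+j}=\frac{1}{\sqrt2}\left(u_{r+j}v_i^T\pm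 u_iv_{r+j}^T\right)$. 3. More explicitly, for every factorization $\Pi_{\mathscr{M}}(\mathfrak{R})=UZ^T$ with $U\in\mathcal{M}_{l,r}$, $U^TU=I$, $Z\in\mathcal{M}_{m,r}$, $\mathrm{rank}(Z)=r$, and every $\mathfrak{X}\in\mathcal{M}_{l,m}$, $$\mathrm{D}_{\mathfrak{X}}\Pi_{\mathscr{M}}(\mathfrak{R})=(I-UU^T)\mathfrak{X}Z(Z^TZ)^{-1}Z^T+UU^T\mathfrak{X}+\sum_{\substack{1\le i\le r\\1\le j\le k}}\frac{\sigma_{r+j}}{\sigma_i^2-\sigma_{r+j}^2}\Big[(\sigma_{r+j}u_{r+j}^T\mathfrak{X}v_i+\sigma_iu_i^T\mathfrak{X}v_{r+j})\,u_{r+j}v_i^T+(\sigma_iu_{r+j}^T\mathfrak{X}v_i+\sigma_{r+j}u_i^T\mathfrak{X}v_{r+j})\,u_iv_{r+j}^T\Big].$$ -/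

import Mathlib

open Matrix Filter Topology
open scoped ContDiff

/- The space of `l × m` real matrices carries the Frobenius norm `‖A‖ = Tr(AᵀA)^{1/2}`. -/
attribute [local instance] Matrix.frobeniusNormedAddCommGroup Matrix.frobeniusNormedSpace

namespace FixedRank

/-- The Frobenius scalar product `⟨A, B⟩ = Tr(AᵀB)`. -/
def frobInner {l m : ℕ} (A B : Matrix (Fin l) (Fin m) ℝ) : ℝ := (Aᵀ * B).trace

/-- The set `ℳ` of `l × m` real matrices of rank exactly `r`. -/
def fixedRank (l m r : ℕ) : Set (Matrix (Fin l) (Fin m) ℝ) := {R | R.rank = r}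

/-- `y` is a point of `S` that minimizes the distance to `x`. -/
def IsNearest {E : Type*} [NormedAddCommGroup E] (S : Set E) (x y : E) : Prop :=
  y ∈ S ∧ ∀ z ∈ S, ‖x - y‖ ≤ ‖x - z‖

open Classical in
/-- The orthogonal projection of `x` onto `S`: the unique point of `S` minimizing the distance
to `x`. (Where there is no such unique point, the value is `0` by convention.) -/
noncomputable def orthProj {E : Type*} [NormedAddCommGroup E] (S : Set E) (x : E) : E :=
  if h : ∃! y, IsNearest S x y then h.choose else 0

/-- The tangent space at `R` of a subset `S` of the space of matrices: the set of the velocities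
at time `0` of the smooth curves drawn on `S` that pass through `R` at time `0`. -/
def tangentSpace {l m : ℕ} (S : Set (Matrix (Fin l) (Fin m) ℝ)) (R : Matrix (Fin l) (Fin m) ℝ) :
    Set (Matrix (Fin l) (Fin m) ℝ) :=
  {X | ∃ (ε : ℝ) (γ : ℝ → Matrix (Fin l) (Fin m) ℝ), 0 < ε ∧
    ContDiffOn ℝ ∞ γ (Set.Ioo (-ε) ε) ∧ (∀ t ∈ Set.Ioo (-ε) ε, γ t ∈ S) ∧
    γ 0 = R ∧ HasDerivAt γ X 0}

/-- `A = ∑_{i < n} σ_i u_i v_iᵀ` is a singular value decomposition of `A`, with `n = rank A` nonzero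
singular values in decreasing order and orthonormal families of singular vectors. -/
structure IsSVD {l m n : ℕ} (A : Matrix (Fin l) (Fin m) ℝ) (σ : Fin n → ℝ)
    (u : Fin n → Fin l → ℝ) (v : Fin n → Fin m → ℝ) : Prop where
  pos : ∀ i, 0 < σ i
  antitone : Antitone σ
  orthonormal_left : ∀ i j, u i ⬝ᵥ u j = if i = j then 1 else 0
  orthonormal_right : ∀ i j, v i ⬝ᵥ v j = if i = j then 1 else 0
  eq_sum : A = ∑ i, σ i • vecMulVec (u i) (v i)

/-- `T` is a rank `r` truncated SVD of `A`: it arises from some SVD of `A` by keeping only the `r`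
highest singular values. -/
def IsTruncatedSVD {l m : ℕ} (r : ℕ) (A T : Matrix (Fin l) (Fin m) ℝ) : Prop :=
  ∃ (n : ℕ) (σ : Fin n → ℝ) (u : Fin n → Fin l → ℝ) (v : Fin n → Fin m → ℝ),
    IsSVD A σ u v ∧ T = ∑ i with i.val < r, σ i • vecMulVec (u i) (v i)

/-- `Φ⁺ = (u' vᵀ + u v'ᵀ) / √2`; below `u = u_i`, `v = v_i`, `u' = u_{r+j}`, `v' = v_{r+j}`. -/
noncomputable def phiPlus {l m : ℕ} (u u' : Fin l → ℝ) (v v' : Fin m → ℝ) :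
    Matrix (Fin l) (Fin m) ℝ :=
  (1 / √2) • (vecMulVec u' v + vecMulVec u v')

/-- `Φ⁻ = (u' vᵀ - u v'ᵀ) / √2`; below `u = u_i`, `v = v_i`, `u' = u_{r+j}`, `v' = v_{r+j}`. -/
noncomputable def phiMinus {l m : ℕ} (u u' : Fin l → ℝ) (v v' : Fin m → ℝ) :
    Matrix (Fin l) (Fin m) ℝ :=
  (1 / √2) • (vecMulVec u' v - vecMulVec u v')

end FixedRank

namespace FixedRank

/-! ### Orthogonal projections, the Frobenius norm and the Ky Fan inequality. -/

section Projections

variable {p q ι κ : Type*} [Fintype p] [Fintype q] [Fintype ι] [Fintype κ]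

/-! Near `A` the truncated SVD of `B` is `P B * B`, where `P B` is the orthogonal projection onto
the first `r` left singular vectors of `B`. One inequality controls it, a quantitative Ky Fan
principle (`BlockSVD.ky_fan`): if the first squared singular values are at least `s` and the others
at most `t`, a projection `P` of trace at most `r` captures less of `‖A‖²` than `U * Uᵀ` does, with
a loss of at least `(s - t) * (r - tr (P * U * Uᵀ))`. Combined with Pythagoras it gives Eckart–Young
with uniqueness. Applied to a nearby `B` it gives `‖P B - U * Uᵀ‖² = O(‖B - A‖)`, hence the
continuity of `P` at `A` and the persistence of the gap.

Singular values may be repeated, so singular vectors are never differentiated. Instead, `P B` is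
symmetric, idempotent and commutes with `B * Bᵀ`. The gap makes the linearization of these equations
injective (`BlockSVD.ker_linearizedEqs`), and an explicit matrix `N + Nᵀ` solves the linearized
system (`BlockSVD.linearizedEqs_projDeriv`). Continuity of `P` then forces the remainder to be `o(‖B
- A‖)` (`BlockSVD.isLittleO_proj`), and the product rule for `P B * B` gives the derivative.

The tangent space at the truncation is the kernel of `Y ↦ (1 - U * Uᵀ) * Y * (1 - V * Vᵀ)`, so the
part of the derivative without singular value coefficients is the orthogonal projection onto it. The
remaining sum is rewritten in terms of `Φ⁺` and `Φ⁻` by `phi_terms_eq`. -/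

theorem norm_sq_eq_trace (M : Matrix p q ℝ) : ‖M‖ ^ 2 = (Mᵀ * M).trace := by
  rw [frobenius_norm_def, ← Real.rpow_natCast, ← Real.rpow_mul (by positivity)]
  norm_num
  simp only [trace, diag, mul_apply, transpose_apply, ← sq]
  exact Finset.sum_comm

theorem trace_transpose_mul_self_nonneg (M : Matrix p q ℝ) : 0 ≤ (Mᵀ * M).trace := by
  rw [← norm_sq_eq_trace]; positivity

theorem transpose_mul_self_diag_nonneg {q : Type*} (M : Matrix p q ℝ) (i : q) :
    0 ≤ (Mᵀ * M) i i := by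
  simp only [mul_apply, transpose_apply, ← sq]
  positivity

/-- `P` is the matrix of an orthogonal projection. -/
structure IsOrthProj (P : Matrix p p ℝ) : Prop where
  symm : Pᵀ = P
  idem : P * P = P

namespace IsOrthProj

variable {P Q : Matrix p p ℝ}

theorem one_sub [DecidableEq p] (hP : IsOrthProj P) : IsOrthProj (1 - P) :=
  ⟨by simp [hP.symm], by rw [mul_sub, sub_mul, sub_mul, hP.idem]; simp⟩

theorem transpose_mul_self {q : Type*} (hP : IsOrthProj P) (M : Matrix p q ℝ) :
    (P * M)ᵀ * (P * M) = Mᵀ * P * M := by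
  rw [transpose_mul, hP.symm, Matrix.mul_assoc, ← Matrix.mul_assoc P, hP.idem, Matrix.mul_assoc]

theorem trace_mul_nonneg (hP : IsOrthProj P) (hQ : IsOrthProj Q) : 0 ≤ (P * Q).trace := by
  have h := trace_transpose_mul_self_nonneg (P * Q)
  rwa [hP.transpose_mul_self, Matrix.mul_assoc, trace_mul_comm, hQ.symm, Matrix.mul_assoc,
    hQ.idem] at h

theorem trace_mul_le (hP : IsOrthProj P) (hQ : IsOrthProj Q) : (P * Q).trace ≤ P.trace := by
  classical
  have h := hP.trace_mul_nonneg hQ.one_sub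
  rw [mul_sub, trace_sub, mul_one] at h
  linarith

theorem norm_sub_sq (hP : IsOrthProj P) (hQ : IsOrthProj Q) :
    ‖P - Q‖ ^ 2 = P.trace + Q.trace - 2 * (P * Q).trace := by
  rw [norm_sq_eq_trace, transpose_sub, hP.symm, hQ.symm, mul_sub, sub_mul, sub_mul, hP.idem,
    hQ.idem, trace_sub, trace_sub, trace_sub, trace_mul_comm Q P]
  ring

theorem norm_mul_sq (hP : IsOrthProj P) (M : Matrix p q ℝ) :
    ‖P * M‖ ^ 2 = (P * (M * Mᵀ)).trace := by
  rw [norm_sq_eq_trace, hP.transpose_mul_self, Matrix.mul_assoc, trace_mul_comm, Matrix.mul_assoc]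

theorem norm_mul_le (hP : IsOrthProj P) (M : Matrix p q ℝ) : ‖P * M‖ ≤ ‖M‖ := by
  classical
  have h1 := hP.norm_mul_sq M
  have h2 := hP.one_sub.norm_mul_sq M
  rw [Matrix.sub_mul 1 P (M * Mᵀ), trace_sub, Matrix.one_mul, ← h1, trace_mul_comm,
    ← norm_sq_eq_trace] at h2
  exact le_of_sq_le_sq (by nlinarith [sq_nonneg ‖(1 - P) * M‖]) (norm_nonneg _)

/-- Pythagoras: if the range of `R` lies in that of `P`, the distance from `M` to `R` splits. -/
theorem norm_sub_sq_of_mul_eq (hP : IsOrthProj P) {R : Matrix p q ℝ} (hR : P * R = R)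
    (M : Matrix p q ℝ) :
    ‖M - R‖ ^ 2 = ‖P * M - R‖ ^ 2 + ‖M‖ ^ 2 - ‖P * M‖ ^ 2 := by
  have h1 : Mᵀ * P * R = Mᵀ * R := by rw [Matrix.mul_assoc, hR]
  have h3 : Rᵀ * P = Rᵀ := by rw [← hP.symm, ← transpose_mul, hR]
  have h2 : Rᵀ * (P * M) = Rᵀ * M := by rw [← Matrix.mul_assoc, h3]
  simp only [norm_sq_eq_trace, transpose_sub, Matrix.sub_mul, Matrix.mul_sub, trace_sub,
    hP.transpose_mul_self, h2]
  simp only [transpose_mul, hP.symm, h1]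
  ring

end IsOrthProj

theorem isOrthProj_mul_transpose [DecidableEq ι] {U : Matrix p ι ℝ} (hU : Uᵀ * U = 1) :
    IsOrthProj (U * Uᵀ) :=
  ⟨by simp, by rw [Matrix.mul_assoc, ← Matrix.mul_assoc Uᵀ, hU, Matrix.one_mul]⟩

theorem trace_mul_transpose [DecidableEq ι] {U : Matrix p ι ℝ} (hU : Uᵀ * U = 1) :
    (U * Uᵀ).trace = Fintype.card ι := by
  rw [trace_mul_comm, hU, trace_one]

/-- A singular value decomposition of `A` whose terms are split into two blocks. -/
structure BlockSVD [DecidableEq ι] [DecidableEq κ] (A : Matrix p q ℝ) (σ : ι → ℝ) (τ : κ → ℝ)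
    (U : Matrix p ι ℝ) (Ub : Matrix p κ ℝ) (V : Matrix q ι ℝ) (Vb : Matrix q κ ℝ) : Prop where
  topU_orth : Uᵀ * U = 1
  topU_botU : Uᵀ * Ub = 0
  botU_orth : Ubᵀ * Ub = 1
  topV_orth : Vᵀ * V = 1
  topV_botV : Vᵀ * Vb = 0
  botV_orth : Vbᵀ * Vb = 1
  eq : A = U * diagonal σ * Vᵀ + Ub * diagonal τ * Vbᵀ

namespace BlockSVD

variable [DecidableEq ι] [DecidableEq κ] {A : Matrix p q ℝ} {σ : ι → ℝ} {τ : κ → ℝ}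
  {U : Matrix p ι ℝ} {Ub : Matrix p κ ℝ} {V : Matrix q ι ℝ} {Vb : Matrix q κ ℝ}

theorem botU_topU (h : BlockSVD A σ τ U Ub V Vb) : Ubᵀ * U = 0 := by
  simpa using congrArg transpose h.topU_botU

/-- This symmetry turns each identity about left singular vectors into one about right singular
vectors. -/
theorem transpose (h : BlockSVD A σ τ U Ub V Vb) : BlockSVD Aᵀ σ τ V Vb U Ub :=
  ⟨h.topV_orth, h.topV_botV, h.botV_orth, h.topU_orth, h.topU_botU, h.botU_orth, by
    simp [h.eq, Matrix.mul_assoc]⟩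

theorem transpose_topU_mul (h : BlockSVD A σ τ U Ub V Vb) : Uᵀ * A = diagonal σ * Vᵀ := by
  rw [h.eq, Matrix.mul_add, ← Matrix.mul_assoc, ← Matrix.mul_assoc, ← Matrix.mul_assoc,
    ← Matrix.mul_assoc, h.topU_orth, h.topU_botU]
  simp

theorem transpose_botU_mul (h : BlockSVD A σ τ U Ub V Vb) : Ubᵀ * A = diagonal τ * Vbᵀ := by
  rw [h.eq, Matrix.mul_add, ← Matrix.mul_assoc, ← Matrix.mul_assoc, ← Matrix.mul_assoc,
    ← Matrix.mul_assoc, h.botU_topU, h.botU_orth]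
  simp

theorem mul_topV (h : BlockSVD A σ τ U Ub V Vb) : A * V = U * diagonal σ := by
  simpa using congrArg Matrix.transpose h.transpose.transpose_topU_mul

theorem mul_botV (h : BlockSVD A σ τ U Ub V Vb) : A * Vb = Ub * diagonal τ := by
  simpa using congrArg Matrix.transpose h.transpose.transpose_botU_mul

theorem isOrthProj (h : BlockSVD A σ τ U Ub V Vb) : IsOrthProj (U * Uᵀ) :=
  isOrthProj_mul_transpose h.topU_orth

theorem proj_mul (h : BlockSVD A σ τ U Ub V Vb) : U * Uᵀ * A = U * diagonal σ * Vᵀ := by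
  rw [Matrix.mul_assoc, h.transpose_topU_mul, Matrix.mul_assoc]

theorem mul_proj (h : BlockSVD A σ τ U Ub V Vb) : A * (V * Vᵀ) = U * diagonal σ * Vᵀ := by
  rw [← Matrix.mul_assoc, h.mul_topV]

theorem mul_transpose_self (h : BlockSVD A σ τ U Ub V Vb) :
    A * Aᵀ = U * diagonal (fun i => σ i ^ 2) * Uᵀ + Ub * diagonal (fun i => τ i ^ 2) * Ubᵀ := by
  conv_lhs => rw [h.transpose.eq]
  rw [Matrix.mul_add, ← Matrix.mul_assoc, ← Matrix.mul_assoc, ← Matrix.mul_assoc,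
    ← Matrix.mul_assoc, h.mul_topV, h.mul_botV, Matrix.mul_assoc U, Matrix.mul_assoc Ub,
    diagonal_mul_diagonal, diagonal_mul_diagonal]
  simp only [sq]

theorem trace_mul_mul_diagonal (P : Matrix p p ℝ) (U : Matrix p ι ℝ) (c : ι → ℝ) :
    (P * (U * diagonal c * Uᵀ)).trace = ∑ i, (Uᵀ * P * U) i i * c i := by
  rw [← Matrix.mul_assoc, trace_mul_comm, ← Matrix.mul_assoc, ← Matrix.mul_assoc]
  simp [trace, mul_diagonal]

/-- A quantitative Ky Fan maximum principle: among the orthogonal projections `P` of rank at most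
`r`, the one onto the first `r` left singular vectors has the greatest `‖P * A‖`. -/
theorem ky_fan (h : BlockSVD A σ τ U Ub V Vb) {s t : ℝ} (hs : ∀ i, s ≤ σ i ^ 2)
    (ht : ∀ j, τ j ^ 2 ≤ t) (ht0 : 0 ≤ t) {P : Matrix p p ℝ} (hP : IsOrthProj P)
    (hPr : P.trace ≤ Fintype.card ι) :
    (s - t) * (Fintype.card ι - (P * (U * Uᵀ)).trace) ≤
      ‖U * Uᵀ * A‖ ^ 2 - ‖P * A‖ ^ 2 := by
  classical
  have hone := trace_mul_mul_diagonal P U (fun _ => 1)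
  have hone' := trace_mul_mul_diagonal P Ub (fun _ => 1)
  -- `U * Uᵀ + Ub * Ubᵀ` is itself a projection, so the weights that `P` gives to all the singular
  -- vectors sum to at most `tr P`.
  have htr : (P * (U * Uᵀ)).trace + (P * (Ub * Ubᵀ)).trace ≤ Fintype.card ι := by
    have hW : IsOrthProj (U * Uᵀ + Ub * Ubᵀ) := by
      refine ⟨by simp, ?_⟩
      have e1 : U * Uᵀ * (Ub * Ubᵀ) = 0 := by
        rw [Matrix.mul_assoc, ← Matrix.mul_assoc Uᵀ, h.topU_botU]; simp
      have e2 : Ub * Ubᵀ * (U * Uᵀ) = 0 := by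
        rw [Matrix.mul_assoc, ← Matrix.mul_assoc Ubᵀ, h.botU_topU]; simp
      rw [Matrix.mul_add, Matrix.add_mul, Matrix.add_mul, h.isOrthProj.idem,
        (isOrthProj_mul_transpose h.botU_orth).idem, e1, e2]
      simp
    rw [← trace_add, ← Matrix.mul_add]
    exact (hP.trace_mul_le hW).trans hPr
  have hA : ‖U * Uᵀ * A‖ ^ 2 = ∑ i, σ i ^ 2 := by
    have e1 : Uᵀ * (U * Uᵀ) * U = 1 := by
      rw [← Matrix.mul_assoc, h.topU_orth, Matrix.one_mul, h.topU_orth]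
    have e2 : Ubᵀ * (U * Uᵀ) * Ub = 0 := by
      rw [← Matrix.mul_assoc, h.botU_topU]; simp
    rw [h.isOrthProj.norm_mul_sq, h.mul_transpose_self, Matrix.mul_add, trace_add,
      trace_mul_mul_diagonal, trace_mul_mul_diagonal, e1, e2]
    simp
  have hPA : ‖P * A‖ ^ 2 =
      ∑ i, (Uᵀ * P * U) i i * σ i ^ 2 + ∑ j, (Ubᵀ * P * Ub) j j * τ j ^ 2 := by
    rw [hP.norm_mul_sq, h.mul_transpose_self, Matrix.mul_add, trace_add,
      trace_mul_mul_diagonal, trace_mul_mul_diagonal]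
  have hle : ∀ i, (Uᵀ * P * U) i i ≤ 1 := fun i => by
    have := transpose_mul_self_diag_nonneg ((1 - P) * U) i
    rw [hP.one_sub.transpose_mul_self, Matrix.mul_sub, Matrix.sub_mul, Matrix.mul_one,
      h.topU_orth] at this
    simpa using this
  have hnn : ∀ j, 0 ≤ (Ubᵀ * P * Ub) j j := fun j => by
    have := transpose_mul_self_diag_nonneg (P * Ub) j
    rwa [hP.transpose_mul_self] at this
  -- Weight missing from the top block costs at least `s` per unit; weight placed on the bottom
  -- block recovers at most `t` per unit.
  have b1 : ∑ i, (1 - (Uᵀ * P * U) i i) * s ≤ ∑ i, (1 - (Uᵀ * P * U) i i) * σ i ^ 2 :=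
    Finset.sum_le_sum fun i _ => mul_le_mul_of_nonneg_left (hs i) (sub_nonneg.2 (hle i))
  have b2 : ∑ j, (Ubᵀ * P * Ub) j j * τ j ^ 2 ≤ ∑ j, (Ubᵀ * P * Ub) j j * t :=
    Finset.sum_le_sum fun j _ => mul_le_mul_of_nonneg_left (ht j) (hnn j)
  simp only [diagonal_one, Matrix.mul_one, mul_one] at hone hone'
  rw [← Finset.sum_mul, Finset.sum_sub_distrib, ← hone] at b1
  rw [← Finset.sum_mul, ← hone'] at b2
  simp only [sub_mul, one_mul, Finset.sum_sub_distrib, Finset.sum_const, Finset.card_univ,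
    nsmul_eq_mul, mul_one] at b1
  rw [hA, hPA]
  nlinarith [mul_le_mul_of_nonneg_right htr ht0]

/-- The distance from a projection of rank at most `r` to the one onto the first `r` left singular
vectors, in terms of a trace. -/
theorem norm_sub_sq_le (h : BlockSVD A σ τ U Ub V Vb) {P : Matrix p p ℝ} (hP : IsOrthProj P)
    (hPr : P.trace ≤ Fintype.card ι) :
    ‖P - U * Uᵀ‖ ^ 2 ≤ 2 * (Fintype.card ι - (P * (U * Uᵀ)).trace) := by
  rw [hP.norm_sub_sq h.isOrthProj, trace_mul_transpose h.topU_orth]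
  linarith

/-- If `P` captures at least as much of a matrix `B` near `A` as the projection onto the first left
singular vectors of `A`, then `P` is close to this projection. -/
theorem perturbation (h : BlockSVD A σ τ U Ub V Vb) {s t : ℝ} (hs : ∀ i, s ≤ σ i ^ 2)
    (ht : ∀ j, τ j ^ 2 ≤ t) (ht0 : 0 ≤ t) {P : Matrix p p ℝ} (hP : IsOrthProj P)
    (hPr : P.trace ≤ Fintype.card ι) {B : Matrix p q ℝ} (hB : ‖U * Uᵀ * B‖ ≤ ‖P * B‖) :
    (s - t) * (Fintype.card ι - (P * (U * Uᵀ)).trace) ≤ 4 * ‖A‖ * ‖B - A‖ := by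
  refine (h.ky_fan hs ht ht0 hP hPr).trans ?_
  have h1 : ‖U * Uᵀ * A‖ ≤ ‖U * Uᵀ * B‖ + ‖B - A‖ := by
    have e : U * Uᵀ * A = U * Uᵀ * B - U * Uᵀ * (B - A) := by rw [Matrix.mul_sub]; abel
    rw [e]
    exact (norm_sub_le _ _).trans (add_le_add_right (h.isOrthProj.norm_mul_le _) _)
  have h2 : ‖P * B‖ ≤ ‖P * A‖ + ‖B - A‖ := by
    have e : P * B = P * A + P * (B - A) := by rw [Matrix.mul_sub]; abel
    rw [e]
    exact (norm_add_le _ _).trans (add_le_add_right (hP.norm_mul_le _) _)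
  have h3 := h.isOrthProj.norm_mul_le A
  have h4 := hP.norm_mul_le A
  have h5 : ‖U * Uᵀ * A‖ - ‖P * A‖ ≤ 2 * ‖B - A‖ := by linarith
  -- Difference of squares: one factor is at most `2 * ‖B - A‖`, the other at most `2 * ‖A‖`.
  nlinarith [norm_nonneg (U * Uᵀ * A), norm_nonneg (P * A), norm_nonneg (B - A), norm_nonneg A,
    mul_le_mul_of_nonneg_right h5 (add_nonneg (norm_nonneg (U * Uᵀ * A)) (norm_nonneg (P * A))),
    mul_le_mul_of_nonneg_left (add_le_add h3 h4) (norm_nonneg (B - A))]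

/-- A quantitative Eckart–Young theorem. -/
theorem eckart_young (h : BlockSVD A σ τ U Ub V Vb) {s t : ℝ} (hs : ∀ i, s ≤ σ i ^ 2)
    (ht : ∀ j, τ j ^ 2 ≤ t) (ht0 : 0 ≤ t) {P : Matrix p p ℝ} (hP : IsOrthProj P)
    (hPr : P.trace ≤ Fintype.card ι) {R : Matrix p q ℝ} (hR : P * R = R) :
    ‖A - U * Uᵀ * A‖ ^ 2 + ‖P * A - R‖ ^ 2 +
      (s - t) * (Fintype.card ι - (P * (U * Uᵀ)).trace) ≤ ‖A - R‖ ^ 2 := by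
  have h1 := hP.norm_sub_sq_of_mul_eq hR A
  have h2 := h.isOrthProj.norm_sub_sq_of_mul_eq (R := U * Uᵀ * A)
    (by rw [← Matrix.mul_assoc, h.isOrthProj.idem]) A
  have h3 := h.ky_fan hs ht ht0 hP hPr
  rw [sub_self, norm_zero] at h2
  linarith

end BlockSVD

end Projections

end FixedRank

namespace FixedRank

/-! ### Existence of singular value decompositions and their block form. -/

section SVD

variable {l m n r k : ℕ}

/-- Every real matrix has a singular value decomposition. -/
theorem exists_isSVD (B : Matrix (Fin l) (Fin m) ℝ) :
    ∃ (n : ℕ) (σ : Fin n → ℝ) (u : Fin n → Fin l → ℝ) (v : Fin n → Fin m → ℝ),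
      IsSVD B σ u v := by
  classical
  have hG : (Bᵀ * B).IsHermitian := by
    simpa using isHermitian_conjTranspose_mul_self B
  set W : Matrix (Fin m) (Fin m) ℝ := hG.eigenvectorUnitary.1 with hW
  have hWW : Wᵀ * W = 1 := by
    have := (Matrix.mem_unitaryGroup_iff' (A := W)).1 hG.eigenvectorUnitary.2
    simpa [star_eq_conjTranspose] using this
  have hWW' : W * Wᵀ = 1 := mul_eq_one_comm.1 hWW
  set lam := hG.eigenvalues
  have hdot : ∀ i j, Wᵀ i ⬝ᵥ Wᵀ j = if i = j then 1 else 0 := fun i j => by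
    have := congrFun (congrFun hWW i) j
    rwa [mul_apply', one_apply] at this
  have hGv : ∀ j, (Bᵀ * B) *ᵥ Wᵀ j = lam j • Wᵀ j := fun j => by
    simpa [hW, hG.eigenvectorUnitary_transpose_apply] using hG.mulVec_eigenvectorBasis j
  have hBB : ∀ i j, (B *ᵥ Wᵀ i) ⬝ᵥ (B *ᵥ Wᵀ j) = if i = j then lam j else 0 := fun i j => by
    rw [dotProduct_comm, dotProduct_mulVec, ← mulVec_transpose, mulVec_mulVec, hGv,
      smul_dotProduct, hdot]
    by_cases h : i = j
    · simp [h]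
    · simp [h, Ne.symm h]
  have hlam : ∀ i, 0 ≤ lam i := fun i => by
    have := hBB i i
    rw [if_pos rfl] at this
    rw [← this]
    exact Finset.sum_nonneg fun a _ => mul_self_nonneg _
  have hsum : B = ∑ i, vecMulVec (B *ᵥ Wᵀ i) (Wᵀ i) := by
    calc B = B * W * Wᵀ := by rw [Matrix.mul_assoc, hWW', Matrix.mul_one]
      _ = _ := by
        ext a b
        simp [mul_apply, Matrix.sum_apply, vecMulVec_apply, mulVec, dotProduct]
  -- Only the positive eigenvalues of `Bᵀ * B` are kept. The minus sign in `f` makes the increasing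
  -- sort list the singular values in decreasing order.
  let ι := {i // 0 < lam i}
  let e : ι ≃ Fin (Fintype.card ι) := Fintype.equivFin ι
  let f : Fin (Fintype.card ι) → ℝ := fun i => - √(lam (e.symm i))
  let g : Fin (Fintype.card ι) ≃ ι := (Tuple.sort f).trans e.symm
  have hg : ∀ i, 0 < √(lam (g i)) := fun i => Real.sqrt_pos.2 (g i).2
  refine ⟨Fintype.card ι, fun i => √(lam (g i)),
    fun i => (√(lam (g i)))⁻¹ • (B *ᵥ Wᵀ (g i)), fun i => Wᵀ (g i), hg, ?_, ?_, ?_, ?_⟩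
  · intro i j hij
    have := Tuple.monotone_sort f hij
    simpa [f, g] using this
  · intro i j
    rw [smul_dotProduct, dotProduct_smul, hBB]
    by_cases h : i = j
    · subst h
      have h2 := Real.mul_self_sqrt (hlam (g i))
      have h3 := (hg i).ne'
      simp only [if_true, smul_eq_mul]
      nth_rw 3 [← h2]
      field_simp
    · rw [if_neg h, if_neg (fun h' => h (g.injective (Subtype.ext h')))]
      simp
  · intro i j
    rw [hdot]
    by_cases h : i = j
    · simp [h]
    · rw [if_neg h, if_neg (fun h' => h (g.injective (Subtype.ext h')))]
  -- For a zero eigenvalue, `‖B w‖² = 0`, so discarding these terms loses nothing.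
  · have hz : ∀ i, ¬ 0 < lam i → vecMulVec (B *ᵥ Wᵀ i) (Wᵀ i) = 0 := fun i hi => by
      have h0 : lam i = 0 := le_antisymm (not_lt.1 hi) (hlam i)
      have := hBB i i
      rw [if_pos rfl, h0, dotProduct_self_eq_zero] at this
      rw [this]; simp
    have key : ∑ i : Fin (Fintype.card ι), √(lam (g i)) •
        vecMulVec ((√(lam (g i)))⁻¹ • (B *ᵥ Wᵀ (g i))) (Wᵀ (g i)) =
        ∑ i : ι, vecMulVec (B *ᵥ Wᵀ i) (Wᵀ i) := by
      rw [← Equiv.sum_comp g]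
      refine Finset.sum_congr rfl fun i _ => ?_
      rw [smul_vecMulVec, smul_smul, mul_inv_cancel₀ (hg i).ne', one_smul]
    rw [key]
    conv_lhs => rw [hsum]
    rw [← Fintype.sum_subtype_add_sum_subtype (fun i => 0 < lam i)]
    rw [Finset.sum_eq_zero (s := (Finset.univ : Finset {i // ¬ 0 < lam i})) (fun i _ => hz i i.2),
      add_zero]

/-- The matrix whose columns are the vectors of a family. -/
def colMatrix {ι : Type*} (w : ι → Fin l → ℝ) : Matrix (Fin l) ι ℝ := (of w)ᵀ

theorem sum_smul_vecMulVec {ι : Type*} [Fintype ι] [DecidableEq ι] (c : ι → ℝ)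
    (u : ι → Fin l → ℝ) (v : ι → Fin m → ℝ) :
    ∑ i, c i • vecMulVec (u i) (v i) = colMatrix u * diagonal c * (colMatrix v)ᵀ := by
  ext a b
  simp only [Matrix.sum_apply, Matrix.smul_apply, vecMulVec_apply, smul_eq_mul]
  rw [mul_apply]
  simp only [mul_diagonal, colMatrix, transpose_apply, of_apply]
  exact Finset.sum_congr rfl fun i _ => by ring

theorem colMatrix_transpose_mul {ι κ : Type*} (u : ι → Fin l → ℝ) (w : κ → Fin l → ℝ) (i : ι)
    (j : κ) : ((colMatrix u)ᵀ * colMatrix w) i j = u i ⬝ᵥ w j := rfl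

theorem filter_sum_eq {M : Type*} [AddCommMonoid M] (f : Fin (r + k) → M) :
    ∑ i with i.val < r, f i = ∑ i : Fin r, f (Fin.castAdd k i) := by
  rw [Finset.sum_filter, Fin.sum_univ_add]
  simp

theorem IsSVD.blockSVD {A : Matrix (Fin l) (Fin m) ℝ} {σ : Fin (r + k) → ℝ}
    {u : Fin (r + k) → Fin l → ℝ} {v : Fin (r + k) → Fin m → ℝ} (h : IsSVD A σ u v) :
    BlockSVD A (fun i => σ (Fin.castAdd k i)) (fun j => σ (Fin.natAdd r j))
      (colMatrix fun i => u (Fin.castAdd k i)) (colMatrix fun j => u (Fin.natAdd r j))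
      (colMatrix fun i => v (Fin.castAdd k i)) (colMatrix fun j => v (Fin.natAdd r j)) := by
  have ne : ∀ (i : Fin r) (j : Fin k), Fin.castAdd k i ≠ Fin.natAdd r j := fun i j hij => by
    have := congrArg Fin.val hij
    simp at this
    omega
  refine ⟨?_, ?_, ?_, ?_, ?_, ?_, ?_⟩
  · ext i j; simp [colMatrix_transpose_mul, h.orthonormal_left, one_apply]
  · ext i j; simp [colMatrix_transpose_mul, h.orthonormal_left, ne]
  · ext i j; simp [colMatrix_transpose_mul, h.orthonormal_left, one_apply]
  · ext i j; simp [colMatrix_transpose_mul, h.orthonormal_right, one_apply]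
  · ext i j; simp [colMatrix_transpose_mul, h.orthonormal_right, ne]
  · ext i j; simp [colMatrix_transpose_mul, h.orthonormal_right, one_apply]
  · rw [← sum_smul_vecMulVec, ← sum_smul_vecMulVec, ← Fin.sum_univ_add fun i =>
      σ i • vecMulVec (u i) (v i)]
    exact h.eq_sum

theorem rank_mul_diagonal_mul_transpose {p q ι : Type*} [Fintype p] [Fintype q] [Fintype ι]
    [DecidableEq ι] {σ : ι → ℝ} {U : Matrix p ι ℝ} {V : Matrix q ι ℝ} (hU : Uᵀ * U = 1)
    (hV : Vᵀ * V = 1) (hσ : ∀ i, σ i ≠ 0) : (U * diagonal σ * Vᵀ).rank = Fintype.card ι := by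
  classical
  apply le_antisymm
  · rw [Matrix.mul_assoc]
    exact (rank_mul_le_left _ _).trans (rank_le_card_width _)
  · have h : Uᵀ * (U * diagonal σ * Vᵀ) * V = diagonal σ := by
      rw [Matrix.mul_assoc U, ← Matrix.mul_assoc, hU, Matrix.one_mul, Matrix.mul_assoc, hV,
        Matrix.mul_one]
    have h1 : (diagonal σ).rank = Fintype.card ι := by
      rw [rank_of_det_ne_zero]
      rw [det_diagonal]
      exact Finset.prod_ne_zero_iff.2 fun i _ => hσ i
    calc Fintype.card ι = (Uᵀ * (U * diagonal σ * Vᵀ) * V).rank := by rw [h, h1]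
      _ ≤ _ := (rank_mul_le_left _ _).trans (rank_mul_le_right _ _)

/-- The orthogonal projection onto the range of a matrix. -/
theorem exists_isOrthProj_range (R : Matrix (Fin l) (Fin m) ℝ) :
    ∃ P : Matrix (Fin l) (Fin l) ℝ, IsOrthProj P ∧ P.trace = R.rank ∧ P * R = R := by
  obtain ⟨n, σ, u, v, h⟩ := exists_isSVD R
  -- With an empty second block, `U * Uᵀ` is the projection onto the whole range.
  have hb := IsSVD.blockSVD (r := n) (k := 0) h
  have hR := hb.proj_mul
  have hRR := hb.eq
  rw [show ∀ M : Matrix (Fin l) (Fin 0) ℝ, ∀ N : Matrix (Fin 0) (Fin m) ℝ, M * N = 0 from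
    fun M N => by ext; simp [mul_apply], add_zero] at hRR
  refine ⟨_, hb.isOrthProj, ?_, hR.trans hRR.symm⟩
  rw [trace_mul_transpose hb.topU_orth]
  conv_rhs => rw [hRR]
  rw [rank_mul_diagonal_mul_transpose hb.topU_orth hb.topV_orth fun i => (h.pos _).ne']

end SVD

end FixedRank

namespace FixedRank

theorem orthProj_eq {E : Type*} [NormedAddCommGroup E] {S : Set E} {x y : E}
    (hy : IsNearest S x y) (huniq : ∀ z, IsNearest S x z → z = y) : orthProj S x = y := by
  have h : ∃! y, IsNearest S x y := ⟨y, hy, huniq⟩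
  rw [orthProj, dif_pos h]
  exact huniq _ h.choose_spec.1

/-! ### Best approximation of rank `r`, and its stability under perturbation. -/

section Nearest

variable {l m r k n : ℕ}

/-- Under a gap condition the truncated singular value decomposition is the only best approximation
of the given rank. -/
theorem BlockSVD.isNearest {κ : Type*} [Fintype κ] [DecidableEq κ]
    {A : Matrix (Fin l) (Fin m) ℝ} {σ : Fin r → ℝ} {τ : κ → ℝ} {U : Matrix (Fin l) (Fin r) ℝ}
    {Ub : Matrix (Fin l) κ ℝ} {V : Matrix (Fin m) (Fin r) ℝ} {Vb : Matrix (Fin m) κ ℝ}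
    (h : BlockSVD A σ τ U Ub V Vb) (hσ : ∀ i, σ i ≠ 0) {s t : ℝ} (hs : ∀ i, s ≤ σ i ^ 2)
    (ht : ∀ j, τ j ^ 2 ≤ t) (ht0 : 0 ≤ t) (hst : t < s) :
    IsNearest (fixedRank l m r) A (U * Uᵀ * A) ∧
      ∀ R, IsNearest (fixedRank l m r) A R → R = U * Uᵀ * A := by
  have hmem : U * Uᵀ * A ∈ fixedRank l m r := by
    change (U * Uᵀ * A).rank = r
    rw [h.proj_mul, rank_mul_diagonal_mul_transpose h.topU_orth h.topV_orth hσ, Fintype.card_fin]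
  have key : ∀ R ∈ fixedRank l m r, ∃ P : Matrix (Fin l) (Fin l) ℝ,
      ‖A - U * Uᵀ * A‖ ^ 2 + ‖P * A - R‖ ^ 2 + (s - t) * (‖P - U * Uᵀ‖ ^ 2 / 2) ≤
        ‖A - R‖ ^ 2 := by
    intro R hR
    obtain ⟨P, hP, hPt, hPR⟩ := exists_isOrthProj_range R
    have hPr : P.trace ≤ Fintype.card (Fin r) := by
      rw [hPt, Fintype.card_fin, show R.rank = r from hR]
    refine ⟨P, le_trans ?_ (h.eckart_young hs ht ht0 hP hPr hPR)⟩
    have := h.norm_sub_sq_le hP hPr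
    have := mul_le_mul_of_nonneg_left this (sub_nonneg.2 hst.le)
    linarith
  refine ⟨⟨hmem, fun R hR => ?_⟩, fun R hR => ?_⟩
  · obtain ⟨P, hP⟩ := key R hR
    have := mul_nonneg (sub_nonneg.2 hst.le) (by positivity : 0 ≤ ‖P - U * Uᵀ‖ ^ 2 / 2)
    exact le_of_sq_le_sq (by nlinarith [sq_nonneg ‖P * A - R‖]) (norm_nonneg _)
  · obtain ⟨P, hP⟩ := key R hR.1
    have h1 := pow_le_pow_left₀ (norm_nonneg _) (hR.2 _ hmem) 2
    have h2 := mul_nonneg (sub_nonneg.2 hst.le) (by positivity : 0 ≤ ‖P - U * Uᵀ‖ ^ 2 / 2)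
    have h3 : ‖P * A - R‖ ^ 2 = 0 := le_antisymm (by linarith) (sq_nonneg _)
    have h4 : (s - t) * (‖P - U * Uᵀ‖ ^ 2 / 2) = 0 :=
      le_antisymm (by linarith [sq_nonneg ‖P * A - R‖]) h2
    have h5 : ‖P - U * Uᵀ‖ ^ 2 = 0 := by
      rcases mul_eq_zero.1 h4 with h | h <;> linarith
    have h6 : P = U * Uᵀ := by
      rw [← sub_eq_zero, ← norm_eq_zero]; exact pow_eq_zero_iff two_ne_zero |>.1 h5
    have h7 : P * A = R := by
      rw [← sub_eq_zero, ← norm_eq_zero]; exact pow_eq_zero_iff two_ne_zero |>.1 h3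
    rw [← h7, h6]

/-- Both sides equal `A * (V * Vᵀ) * Aᵀ`, which is symmetric. -/
theorem BlockSVD.proj_comm {p q ι κ : Type*} [Fintype p] [Fintype q] [Fintype ι] [Fintype κ]
    [DecidableEq ι] [DecidableEq κ] {A : Matrix p q ℝ} {σ : ι → ℝ} {τ : κ → ℝ}
    {U : Matrix p ι ℝ} {Ub : Matrix p κ ℝ} {V : Matrix q ι ℝ} {Vb : Matrix q κ ℝ}
    (h : BlockSVD A σ τ U Ub V Vb) : U * Uᵀ * (A * Aᵀ) = A * Aᵀ * (U * Uᵀ) := by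
  have h1 : U * Uᵀ * (A * Aᵀ) = A * (V * Vᵀ) * Aᵀ := by
    rw [← Matrix.mul_assoc, h.proj_mul, h.mul_proj]
  have h2 := congrArg Matrix.transpose h1
  simp only [transpose_mul, transpose_transpose] at h2
  rw [h1, h2, Matrix.mul_assoc]

/-- The gap is conditional on `0 < k` because a nearby matrix may have rank exactly `r`; then `t =
0` serves. -/
theorem IsSVD.exists_gap (hr : 0 < r) {A : Matrix (Fin l) (Fin m) ℝ} {σ : Fin (r + k) → ℝ}
    {u : Fin (r + k) → Fin l → ℝ} {v : Fin (r + k) → Fin m → ℝ} (h : IsSVD A σ u v)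
    (hgap : ∀ hk : 0 < k, σ (Fin.natAdd r ⟨0, hk⟩) <
      σ (Fin.castAdd k ⟨r - 1, Nat.sub_one_lt_of_lt hr⟩)) :
    ∃ s t : ℝ, 0 ≤ t ∧ t < s ∧ (∀ i, s ≤ σ (Fin.castAdd k i) ^ 2) ∧
      ∀ j, σ (Fin.natAdd r j) ^ 2 ≤ t := by
  have hs : ∀ i : Fin r, σ (Fin.castAdd k ⟨r - 1, Nat.sub_one_lt_of_lt hr⟩) ^ 2 ≤
      σ (Fin.castAdd k i) ^ 2 := fun i => by
    refine pow_le_pow_left₀ (h.pos _).le (h.antitone ?_) 2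
    rw [Fin.le_def]; simp; omega
  rcases Nat.eq_zero_or_pos k with hk | hk
  · subst hk
    exact ⟨_, 0, le_rfl, pow_pos (h.pos _) 2, hs, fun j => j.elim0⟩
  · refine ⟨_, σ (Fin.natAdd r ⟨0, hk⟩) ^ 2, sq_nonneg _,
      pow_lt_pow_left₀ (hgap hk) (h.pos _).le two_ne_zero, hs, fun j => ?_⟩
    refine pow_le_pow_left₀ (h.pos _).le (h.antitone ?_) 2
    rw [Fin.le_def]; simp

section Perturbation

variable {κ : Type*} [Fintype κ] [DecidableEq κ]
  {A : Matrix (Fin l) (Fin m) ℝ} {σ : Fin r → ℝ} {τ : κ → ℝ} {U : Matrix (Fin l) (Fin r) ℝ}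
  {Ub : Matrix (Fin l) κ ℝ} {V : Matrix (Fin m) (Fin r) ℝ} {Vb : Matrix (Fin m) κ ℝ} {s t : ℝ}
  {B : Matrix (Fin l) (Fin m) ℝ}

/-- If `n < r`, the range projection of `B` captures all of `B`, yet its trace against `U * Uᵀ` is
at most `r - 1`; `perturbation` then bounds `s - t` by `4 * ‖A‖ * ‖B - A‖`. -/
theorem BlockSVD.le_of_near (h : BlockSVD A σ τ U Ub V Vb) (hs : ∀ i, s ≤ σ i ^ 2)
    (ht : ∀ j, τ j ^ 2 ≤ t) (ht0 : 0 ≤ t) (hB : 4 * ‖A‖ * ‖B - A‖ < s - t)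
    {ρ : Fin n → ℝ} {u : Fin n → Fin l → ℝ} {v : Fin n → Fin m → ℝ} (hsvd : IsSVD B ρ u v) :
    r ≤ n := by
  by_contra hn
  push Not at hn
  have hb := IsSVD.blockSVD (r := n) (k := 0) hsvd
  have hPB := hb.proj_mul
  have hBB := hb.eq
  rw [show ∀ M : Matrix (Fin l) (Fin 0) ℝ, ∀ N : Matrix (Fin 0) (Fin m) ℝ, M * N = 0 from
    fun M N => by ext; simp [mul_apply], add_zero, ← hPB] at hBB
  have htr := trace_mul_transpose hb.topU_orth
  have hn' : (n : ℝ) + 1 ≤ r := by exact_mod_cast hn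
  rw [Fintype.card_fin] at htr
  have h1 := h.perturbation hs ht ht0 hb.isOrthProj (by rw [htr, Fintype.card_fin]; linarith)
    (B := B) (by rw [← hBB]; exact h.isOrthProj.norm_mul_le B)
  have h2 := hb.isOrthProj.trace_mul_le h.isOrthProj
  rw [htr] at h2
  rw [Fintype.card_fin] at h1
  have h3 : 0 ≤ s - t := le_trans (by positivity) hB.le
  nlinarith

/-- A Hölder estimate of exponent 1/2 for the singular projection. It needs no gap for `B`, which
lets it serve to prove that the gap persists. -/
theorem BlockSVD.norm_proj_sub_sq_le (hr : 0 < r) (h : BlockSVD A σ τ U Ub V Vb)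
    (hs : ∀ i, s ≤ σ i ^ 2) (ht : ∀ j, τ j ^ 2 ≤ t) (ht0 : 0 ≤ t) (hst : t < s)
    {ρ : Fin (r + k) → ℝ} {u : Fin (r + k) → Fin l → ℝ} {v : Fin (r + k) → Fin m → ℝ}
    (hsvd : IsSVD B ρ u v) :
    (s - t) * ‖colMatrix (fun i => u (Fin.castAdd k i)) *
      (colMatrix (fun i => u (Fin.castAdd k i)))ᵀ - U * Uᵀ‖ ^ 2 ≤ 8 * ‖A‖ * ‖B - A‖ := by
  have hb := hsvd.blockSVD
  have hPr : (colMatrix (fun i => u (Fin.castAdd k i)) *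
      (colMatrix (fun i => u (Fin.castAdd k i)))ᵀ).trace ≤ Fintype.card (Fin r) :=
    (trace_mul_transpose hb.topU_orth).le
  -- Ky Fan is applied to `B`, tested against `U * Uᵀ`, with both thresholds equal to the `r`-th
  -- squared singular value: only the sign of the difference is wanted.
  have hk := hb.ky_fan (s := ρ (Fin.castAdd k ⟨r - 1, Nat.sub_one_lt_of_lt hr⟩) ^ 2)
    (t := ρ (Fin.castAdd k ⟨r - 1, Nat.sub_one_lt_of_lt hr⟩) ^ 2)
    (fun i => by
      refine pow_le_pow_left₀ (hsvd.pos _).le (hsvd.antitone ?_) 2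
      rw [Fin.le_def]; simp; omega)
    (fun j => by
      refine pow_le_pow_left₀ (hsvd.pos _).le (hsvd.antitone ?_) 2
      rw [Fin.le_def]; simp; omega)
    (sq_nonneg _) h.isOrthProj (trace_mul_transpose h.topU_orth).le
  rw [sub_self, zero_mul, sub_nonneg] at hk
  have h1 := h.perturbation hs ht ht0 hb.isOrthProj hPr
    (le_of_sq_le_sq hk (norm_nonneg _))
  have h2 := mul_le_mul_of_nonneg_left (h.norm_sub_sq_le hb.isOrthProj hPr) (sub_nonneg.2 hst.le)
  linarith

/-- A gap between two consecutive singular values persists under small perturbations: if it closed,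
the two singular vectors could be exchanged, although the projection onto the first `r` singular
vectors is almost determined. -/
theorem BlockSVD.gap_of_near (hr : 0 < r) (h : BlockSVD A σ τ U Ub V Vb)
    (hs : ∀ i, s ≤ σ i ^ 2) (ht : ∀ j, τ j ^ 2 ≤ t) (ht0 : 0 ≤ t) (hst : t < s)
    (hB : 32 * ‖A‖ * ‖B - A‖ < s - t)
    {ρ : Fin (r + k) → ℝ} {u : Fin (r + k) → Fin l → ℝ} {v : Fin (r + k) → Fin m → ℝ}
    (hsvd : IsSVD B ρ u v) (hk : 0 < k) :
    ρ (Fin.natAdd r ⟨0, hk⟩) < ρ (Fin.castAdd k ⟨r - 1, Nat.sub_one_lt_of_lt hr⟩) := by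
  set a : Fin r := ⟨r - 1, Nat.sub_one_lt_of_lt hr⟩
  set b : Fin k := ⟨0, hk⟩
  refine lt_of_le_of_ne (hsvd.antitone (by rw [Fin.le_def]; simp [a, b])) fun heq => ?_
  set e : Equiv.Perm (Fin (r + k)) := Equiv.swap (Fin.castAdd k a) (Fin.natAdd r b)
  have hρ : ∀ i, ρ (e i) = ρ i := fun i => by
    simp only [e, Equiv.swap_apply_def]
    split_ifs with h1 h2
    · rw [h1, heq]
    · rw [h2, heq]
    · rfl
  have hsvd' : IsSVD B ρ (u ∘ e) (v ∘ e) := by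
    refine ⟨hsvd.pos, hsvd.antitone, fun i j => ?_, fun i j => ?_, ?_⟩
    · simp [hsvd.orthonormal_left]
    · simp [hsvd.orthonormal_right]
    · rw [hsvd.eq_sum, ← Equiv.sum_comp e]
      exact Finset.sum_congr rfl fun i _ => by rw [hρ]; rfl
  have n1 := h.norm_proj_sub_sq_le hr hs ht ht0 hst hsvd
  have n2 := h.norm_proj_sub_sq_le hr hs ht ht0 hst hsvd'
  have hb1 := hsvd.blockSVD
  have hb2 := hsvd'.blockSVD
  set P := colMatrix (fun i => u (Fin.castAdd k i)) *
      (colMatrix (fun i => u (Fin.castAdd k i)))ᵀ with hP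
  set P' := colMatrix (fun i => (u ∘ e) (Fin.castAdd k i)) *
      (colMatrix (fun i => (u ∘ e) (Fin.castAdd k i)))ᵀ with hP'
  -- The constant 32 is `8 * 4`: each projection is within `1/2` of `U * Uᵀ`, so the two are at
  -- distance less than 1.
  have small : ∀ x : ℝ, (s - t) * x ^ 2 ≤ 8 * ‖A‖ * ‖B - A‖ → x < 1 / 2 := fun x hx => by
    by_contra hx'
    push Not at hx'
    nlinarith [mul_le_mul_of_nonneg_left (pow_le_pow_left₀ (by norm_num) hx' 2)
      (sub_nonneg.2 hst.le)]
  have hPP' : ‖P' - P‖ < 1 := by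
    have := norm_sub_le (P' - U * Uᵀ) (P - U * Uᵀ)
    rw [sub_sub_sub_cancel_right] at this
    linarith [small _ n1, small _ n2]
  -- This unit vector is killed by `P` and fixed by `P'`, which forces `‖P' - P‖ ≥ 1`.
  let W : Matrix (Fin l) (Fin 1) ℝ := colMatrix fun _ => u (Fin.natAdd r b)
  have hPW : P * W = 0 := by
    have : (colMatrix (fun i => u (Fin.castAdd k i)))ᵀ * W = 0 := by
      ext i j
      exact congrFun (congrFun hb1.topU_botU i) b
    rw [hP, Matrix.mul_assoc, this, Matrix.mul_zero]
  have hP'W : P' * W = W := by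
    have h1 : P' * colMatrix (fun i => (u ∘ e) (Fin.castAdd k i)) =
        colMatrix (fun i => (u ∘ e) (Fin.castAdd k i)) := by
      rw [hP', Matrix.mul_assoc, hb2.topU_orth, Matrix.mul_one]
    have h2 : (u ∘ e) (Fin.castAdd k a) = u (Fin.natAdd r b) := by simp [e]
    ext x y
    have h3 := congrFun (congrFun h1 x) a
    simp only [colMatrix, mul_apply, transpose_apply, of_apply] at h3
    rw [h2] at h3
    simpa only [W, colMatrix, mul_apply, transpose_apply, of_apply] using h3
  have hW : ‖W‖ = 1 := by
    have h1 : Wᵀ * W = 1 := by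
      ext i j
      rw [Subsingleton.elim j i]
      change u (Fin.natAdd r b) ⬝ᵥ u (Fin.natAdd r b) = _
      rw [hsvd.orthonormal_left]; simp
    have h2 := norm_sq_eq_trace W
    exact (pow_eq_one_iff_of_nonneg (norm_nonneg W) two_ne_zero).1 (by rw [h2, h1]; simp)
  have h1 := frobenius_norm_mul (P' - P) W
  rw [Matrix.sub_mul, hPW, hP'W, sub_zero, hW] at h1
  linarith

/-- Near a matrix with a gap after its `r` first singular values, the truncated singular value
decomposition is the unique nearest point of rank `r`, and it is given by a projection that is
close to the one of the original matrix. -/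
theorem BlockSVD.truncated_of_near (hr : 0 < r) (h : BlockSVD A σ τ U Ub V Vb)
    (hs : ∀ i, s ≤ σ i ^ 2) (ht : ∀ j, τ j ^ 2 ≤ t) (ht0 : 0 ≤ t) (hst : t < s)
    (hB : 32 * ‖A‖ * ‖B - A‖ < s - t)
    {ρ : Fin n → ℝ} {u : Fin n → Fin l → ℝ} {v : Fin n → Fin m → ℝ} (hsvd : IsSVD B ρ u v) :
    ∃ P : Matrix (Fin l) (Fin l) ℝ, IsOrthProj P ∧ P * (B * Bᵀ) = B * Bᵀ * P ∧
      (s - t) * ‖P - U * Uᵀ‖ ^ 2 ≤ 8 * ‖A‖ * ‖B - A‖ ∧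
      ∑ i with i.val < r, ρ i • vecMulVec (u i) (v i) = P * B ∧
      IsNearest (fixedRank l m r) B (P * B) ∧
      ∀ R, IsNearest (fixedRank l m r) B R → R = P * B := by
  have hn : r ≤ n := h.le_of_near hs ht ht0
    (by nlinarith [mul_nonneg (norm_nonneg A) (norm_nonneg (B - A))]) hsvd
  obtain ⟨k, rfl⟩ := Nat.exists_eq_add_of_le hn
  obtain ⟨s', t', ht0', hst', hs', ht'⟩ := hsvd.exists_gap hr
    (h.gap_of_near hr hs ht ht0 hst hB hsvd)
  have hb := hsvd.blockSVD
  obtain ⟨h1, h2⟩ := hb.isNearest (fun i => (hsvd.pos _).ne') hs' ht' ht0' hst'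
  refine ⟨_, hb.isOrthProj, hb.proj_comm, h.norm_proj_sub_sq_le hr hs ht ht0 hst hsvd, ?_, h1, h2⟩
  rw [filter_sum_eq, sum_smul_vecMulVec, hb.proj_mul]

end Perturbation

end Nearest

end FixedRank

namespace FixedRank

/-! ### The linearized equations of the singular projection and their explicit solution. -/

section Derivative

variable {p q ι κ : Type*} [Fintype p] [Fintype q] [Fintype ι] [Fintype κ]

theorem isLittleO_mul_of_tendsto {α o : Type*} [Fintype o] {F : Filter α} {f : α → Matrix p q ℝ}
    {g : α → Matrix q o ℝ} {φ : α → ℝ} (hf : Tendsto f F (𝓝 0)) (hg : g =O[F] φ) :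
    (fun x => f x * g x) =o[F] φ := by
  have h1 : (fun x => ‖f x‖) =o[F] (fun _ => (1 : ℝ)) :=
    (Asymptotics.isLittleO_one_iff ℝ).2 (by simpa using hf.norm)
  have h2 := h1.mul_isBigO hg.norm_left
  simp only [one_mul] at h2
  refine (Asymptotics.isBigO_of_le _ fun x => ?_).trans_isLittleO h2
  rw [norm_mul, norm_norm, norm_norm]
  exact frobenius_norm_mul _ _

theorem isLittleO_mul_of_tendsto_right {α o : Type*} [Fintype o] {F : Filter α}
    {f : α → Matrix p q ℝ} {g : α → Matrix q o ℝ} {φ : α → ℝ} (hf : f =O[F] φ)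
    (hg : Tendsto g F (𝓝 0)) : (fun x => f x * g x) =o[F] φ := by
  have h1 : (fun x => ‖g x‖) =o[F] (fun _ => (1 : ℝ)) :=
    (Asymptotics.isLittleO_one_iff ℝ).2 (by simpa using hg.norm)
  have h2 := hf.norm_left.mul_isLittleO h1
  simp only [mul_one] at h2
  refine (Asymptotics.isBigO_of_le _ fun x => ?_).trans_isLittleO h2
  rw [norm_mul, norm_norm, norm_norm]
  exact frobenius_norm_mul _ _

theorem isBigO_mul_const {α o : Type*} [Fintype o] {F : Filter α} (f : α → Matrix p q ℝ)
    (M : Matrix q o ℝ) : (fun x => f x * M) =O[F] f :=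
  Asymptotics.IsBigO.of_bound ‖M‖ (Eventually.of_forall fun x => by
    rw [mul_comm]; exact frobenius_norm_mul _ _)

theorem isBigO_const_mul {α o : Type*} [Fintype o] {F : Filter α} (M : Matrix p q ℝ)
    (f : α → Matrix q o ℝ) : (fun x => M * f x) =O[F] f :=
  Asymptotics.IsBigO.of_bound ‖M‖ (Eventually.of_forall fun _ => frobenius_norm_mul _ _)

/-- The linearization at `P₀` of the equations satisfied by an orthogonal projection that commutes
with a symmetric matrix near `K`. -/
noncomputable def linearizedEqs (P₀ K : Matrix p p ℝ) :
    Matrix p p ℝ →ₗ[ℝ] Matrix p p ℝ × Matrix p p ℝ × Matrix p p ℝ where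
  toFun D := (D - P₀ * D - D * P₀, D * K - K * D, D - Dᵀ)
  map_add' D D' := by
    simp only [Prod.mk_add_mk, mul_add, add_mul, transpose_add]
    exact Prod.ext (by simp; abel) (Prod.ext (by simp; abel) (by simp; abel))
  map_smul' c D := by
    simp [smul_sub]

namespace BlockSVD

variable [DecidableEq ι] [DecidableEq κ]
  {A : Matrix p q ℝ} {σ : ι → ℝ} {τ : κ → ℝ}
  {U : Matrix p ι ℝ} {Ub : Matrix p κ ℝ} {V : Matrix q ι ℝ} {Vb : Matrix q κ ℝ}

theorem pinv_mul (h : BlockSVD A σ τ U Ub V Vb) (hσ : ∀ i, σ i ≠ 0) :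
    V * diagonal (fun i => (σ i)⁻¹) * Uᵀ * A = V * Vᵀ := by
  rw [Matrix.mul_assoc, h.transpose_topU_mul, Matrix.mul_assoc, ← Matrix.mul_assoc (diagonal _),
    diagonal_mul_diagonal]
  simp [hσ]

theorem mul_pinv (h : BlockSVD A σ τ U Ub V Vb) (hσ : ∀ i, σ i ≠ 0) :
    A * (V * diagonal (fun i => (σ i)⁻¹) * Uᵀ) = U * Uᵀ := by
  rw [← Matrix.mul_assoc, ← Matrix.mul_assoc, h.mul_topV, Matrix.mul_assoc U, diagonal_mul_diagonal]
  simp [hσ]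

/-- The first equation kills the block `Uᵀ D U`. Commutation with `A * Aᵀ` is a Sylvester equation
for `Ubᵀ D U`, with factors `σ i ^ 2 - τ j ^ 2`, and it also kills the part of `D U` in the left
null space of `A` because `σ i ≠ 0`. Symmetry and the first equation then give `D = 0`. -/
theorem ker_linearizedEqs (h : BlockSVD A σ τ U Ub V Vb) (hσ : ∀ i, σ i ≠ 0)
    (hgap : ∀ i j, σ i ^ 2 - τ j ^ 2 ≠ 0) :
    LinearMap.ker (linearizedEqs (U * Uᵀ) (A * Aᵀ)) = ⊥ := by
  rw [LinearMap.ker_eq_bot']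
  intro D hD
  have h1 : D = U * Uᵀ * D + D * (U * Uᵀ) := by
    rw [← sub_eq_zero, ← sub_sub]; exact congrArg Prod.fst hD
  have h2 : D * (A * Aᵀ) = A * Aᵀ * D := by
    rw [← sub_eq_zero]; exact congrArg (fun x => x.2.1) hD
  have h3 : D = Dᵀ := by
    rw [← sub_eq_zero]; exact congrArg (fun x => x.2.2) hD
  have h4 : Uᵀ * (D * U) = 0 := by
    have := congrArg (fun M => Uᵀ * (M * U)) h1
    simp only [Matrix.add_mul, Matrix.mul_add, Matrix.mul_assoc, h.topU_orth,
      Matrix.mul_one] at this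
    rw [← Matrix.mul_assoc Uᵀ U, h.topU_orth, Matrix.one_mul] at this
    simpa using this
  have h5 : Ub * (diagonal (fun i => τ i ^ 2) * (Ubᵀ * (D * U))) =
      D * U * diagonal (fun i => σ i ^ 2) := by
    have e1 : A * Aᵀ * U = U * diagonal (fun i => σ i ^ 2) := by
      rw [h.mul_transpose_self, Matrix.add_mul, Matrix.mul_assoc _ Uᵀ U, h.topU_orth,
        Matrix.mul_assoc _ Ubᵀ U, h.botU_topU]
      simp
    have e2 : A * Aᵀ * (D * U) = D * U * diagonal (fun i => σ i ^ 2) := by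
      rw [← Matrix.mul_assoc, ← h2, Matrix.mul_assoc, e1, Matrix.mul_assoc]
    rw [← e2, h.mul_transpose_self, Matrix.add_mul, Matrix.mul_assoc _ Uᵀ, h4]
    simp only [Matrix.mul_assoc, Matrix.mul_zero, zero_add]
  have h6 : Ubᵀ * (D * U) = 0 := by
    have e := congrArg (fun M => Ubᵀ * M) h5
    rw [← Matrix.mul_assoc, h.botU_orth, Matrix.one_mul, ← Matrix.mul_assoc Ubᵀ (D * U)] at e
    ext j i
    have e' := congrFun (congrFun e j) i
    rw [diagonal_mul, mul_diagonal] at e'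
    have : (σ i ^ 2 - τ j ^ 2) * (Ubᵀ * (D * U)) j i = 0 := by linarith
    exact (mul_eq_zero.1 this).resolve_left (hgap i j)
  have h7 : D * U = 0 := by
    rw [h6, Matrix.mul_zero, Matrix.mul_zero] at h5
    ext a i
    have e := congrFun (congrFun h5 a) i
    rw [mul_diagonal] at e
    exact (mul_eq_zero.1 e.symm).resolve_right (pow_ne_zero 2 (hσ i))
  have h8 : Uᵀ * D = 0 := by
    have := congrArg Matrix.transpose h7
    rwa [transpose_mul, ← h3, transpose_zero] at this
  rw [h1, ← Matrix.mul_assoc, h7, Matrix.mul_assoc, h8]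
  simp

end BlockSVD

/-- The coefficients of `u_{r+j} v_iᵀ` in the derivative of the truncation. -/
noncomputable def coeffLeft (σ : ι → ℝ) (τ : κ → ℝ) (U : Matrix p ι ℝ) (Ub : Matrix p κ ℝ)
    (V : Matrix q ι ℝ) (Vb : Matrix q κ ℝ) : Matrix p q ℝ →ₗ[ℝ] Matrix κ ι ℝ where
  toFun X := of fun j i => τ j / (σ i ^ 2 - τ j ^ 2) *
    (τ j * (Ubᵀ * X * V) j i + σ i * (Uᵀ * X * Vb) i j)
  map_add' X Y := by
    ext j i
    simp only [Matrix.mul_add, Matrix.add_mul, Matrix.add_apply, of_apply]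
    ring
  map_smul' c X := by
    ext j i
    simp only [Matrix.mul_smul, Matrix.smul_mul, Matrix.smul_apply, of_apply, smul_eq_mul,
      RingHom.id_apply]
    ring

/-- The coefficients of `u_i v_{r+j}ᵀ` in the derivative of the truncation. -/
noncomputable def coeffRight (σ : ι → ℝ) (τ : κ → ℝ) (U : Matrix p ι ℝ) (Ub : Matrix p κ ℝ)
    (V : Matrix q ι ℝ) (Vb : Matrix q κ ℝ) : Matrix p q ℝ →ₗ[ℝ] Matrix κ ι ℝ where
  toFun X := of fun j i => τ j / (σ i ^ 2 - τ j ^ 2) *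
    (σ i * (Ubᵀ * X * V) j i + τ j * (Uᵀ * X * Vb) i j)
  map_add' X Y := by
    ext j i
    simp only [Matrix.mul_add, Matrix.add_mul, Matrix.add_apply, of_apply]
    ring
  map_smul' c X := by
    ext j i
    simp only [Matrix.mul_smul, Matrix.smul_mul, Matrix.smul_apply, of_apply, smul_eq_mul,
      RingHom.id_apply]
    ring

/-- The derivative of the truncated singular value decomposition. -/
noncomputable def truncationDeriv [DecidableEq p] (σ : ι → ℝ) (τ : κ → ℝ) (U : Matrix p ι ℝ)
    (Ub : Matrix p κ ℝ) (V : Matrix q ι ℝ) (Vb : Matrix q κ ℝ) :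
    Matrix p q ℝ →ₗ[ℝ] Matrix p q ℝ where
  toFun X := (1 - U * Uᵀ) * X * (V * Vᵀ) + U * Uᵀ * X +
    (Ub * coeffLeft σ τ U Ub V Vb X * Vᵀ + U * (coeffRight σ τ U Ub V Vb X)ᵀ * Vbᵀ)
  map_add' X Y := by
    simp only [map_add, transpose_add, Matrix.mul_add, Matrix.add_mul]
    abel
  map_smul' c X := by
    simp only [map_smul, transpose_smul, Matrix.mul_smul, Matrix.smul_mul, smul_add,
      RingHom.id_apply]

/-- The lower left block of the derivative of the projection onto the first left singular
vectors. -/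
noncomputable def projDerivBlock [DecidableEq p] [DecidableEq ι] (σ : ι → ℝ) (τ : κ → ℝ)
    (U : Matrix p ι ℝ) (Ub : Matrix p κ ℝ) (V : Matrix q ι ℝ) (Vb : Matrix q κ ℝ) :
    Matrix p q ℝ →ₗ[ℝ] Matrix p p ℝ where
  toFun X := ((1 - U * Uᵀ) * X + Ub * coeffLeft σ τ U Ub V Vb X * Vᵀ) *
    (V * diagonal (fun i => (σ i)⁻¹) * Uᵀ)
  map_add' X Y := by
    simp only [map_add, Matrix.mul_add, Matrix.add_mul]
    abel
  map_smul' c X := by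
    simp only [map_smul, Matrix.mul_smul, Matrix.smul_mul, ← smul_add, RingHom.id_apply]

namespace BlockSVD

variable [DecidableEq ι] [DecidableEq κ] [DecidableEq p]
  {A : Matrix p q ℝ} {σ : ι → ℝ} {τ : κ → ℝ}
  {U : Matrix p ι ℝ} {Ub : Matrix p κ ℝ} {V : Matrix q ι ℝ} {Vb : Matrix q κ ℝ}

theorem one_sub_proj_mul (h : BlockSVD A σ τ U Ub V Vb) :
    (1 - U * Uᵀ) * A = Ub * diagonal τ * Vbᵀ := by
  rw [Matrix.sub_mul, h.proj_mul, Matrix.one_mul]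
  nth_rw 1 [h.eq]
  abel

theorem proj_mul_projDerivBlock (h : BlockSVD A σ τ U Ub V Vb) (X : Matrix p q ℝ) :
    U * Uᵀ * projDerivBlock σ τ U Ub V Vb X = 0 := by
  have e1 : U * Uᵀ * (1 - U * Uᵀ) = 0 := by
    rw [Matrix.mul_sub, h.isOrthProj.idem, Matrix.mul_one, sub_self]
  have e2 : U * Uᵀ * Ub = 0 := by rw [Matrix.mul_assoc, h.topU_botU, Matrix.mul_zero]
  change U * Uᵀ * (((1 - U * Uᵀ) * X + Ub * coeffLeft σ τ U Ub V Vb X * Vᵀ) *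
    (V * diagonal (fun i => (σ i)⁻¹) * Uᵀ)) = 0
  rw [← Matrix.mul_assoc, Matrix.mul_add, ← Matrix.mul_assoc _ (1 - U * Uᵀ), e1,
    Matrix.mul_assoc Ub, ← Matrix.mul_assoc _ Ub, e2]
  simp

theorem projDerivBlock_mul_proj (h : BlockSVD A σ τ U Ub V Vb) (X : Matrix p q ℝ) :
    projDerivBlock σ τ U Ub V Vb X * (U * Uᵀ) = projDerivBlock σ τ U Ub V Vb X := by
  change ((1 - U * Uᵀ) * X + Ub * coeffLeft σ τ U Ub V Vb X * Vᵀ) *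
    (V * diagonal (fun i => (σ i)⁻¹) * Uᵀ) * (U * Uᵀ) = ((1 - U * Uᵀ) * X +
    Ub * coeffLeft σ τ U Ub V Vb X * Vᵀ) * (V * diagonal (fun i => (σ i)⁻¹) * Uᵀ)
  rw [Matrix.mul_assoc, Matrix.mul_assoc _ Uᵀ, ← Matrix.mul_assoc Uᵀ, h.topU_orth, Matrix.one_mul]

theorem projDerivBlock_mul (h : BlockSVD A σ τ U Ub V Vb) (hσ : ∀ i, σ i ≠ 0)
    (X : Matrix p q ℝ) :
    projDerivBlock σ τ U Ub V Vb X * A =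
      (1 - U * Uᵀ) * X * (V * Vᵀ) + Ub * coeffLeft σ τ U Ub V Vb X * Vᵀ := by
  change ((1 - U * Uᵀ) * X + Ub * coeffLeft σ τ U Ub V Vb X * Vᵀ) *
    (V * diagonal (fun i => (σ i)⁻¹) * Uᵀ) * A = _
  rw [Matrix.mul_assoc, h.pinv_mul hσ, Matrix.add_mul, Matrix.mul_assoc _ Vᵀ,
    ← Matrix.mul_assoc Vᵀ, h.topV_orth,
    Matrix.one_mul]

/-- Transposed, this says that `Nᵀ * A` supplies the `u_i v_{r+j}ᵀ` terms of the derivative, while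
`N * A` supplies the `u_{r+j} v_iᵀ` terms. -/
theorem transpose_mul_projDerivBlock (h : BlockSVD A σ τ U Ub V Vb) (hσ : ∀ i, σ i ≠ 0)
    (hgap : ∀ i j, σ i ^ 2 - τ j ^ 2 ≠ 0) (X : Matrix p q ℝ) :
    Aᵀ * projDerivBlock σ τ U Ub V Vb X = Vb * coeffRight σ τ U Ub V Vb X * Uᵀ := by
  have e1 : Aᵀ * (1 - U * Uᵀ) = Vb * diagonal τ * Ubᵀ := by
    have := congrArg Matrix.transpose h.one_sub_proj_mul
    simpa [Matrix.mul_assoc] using this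
  have e2 : Aᵀ * Ub = Vb * diagonal τ := h.transpose.mul_botV
  have e3 : diagonal τ * (Ubᵀ * X * V + coeffLeft σ τ U Ub V Vb X) *
      diagonal (fun i => (σ i)⁻¹) = coeffRight σ τ U Ub V Vb X := by
    ext j i
    rw [mul_diagonal, diagonal_mul]
    simp only [Matrix.add_apply, coeffLeft, coeffRight, LinearMap.coe_mk, AddHom.coe_mk, of_apply]
    have := hσ i
    have := hgap i j
    field_simp
    ring
  change Aᵀ * (((1 - U * Uᵀ) * X + Ub * coeffLeft σ τ U Ub V Vb X * Vᵀ) *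
    (V * diagonal (fun i => (σ i)⁻¹) * Uᵀ)) = _
  have e4 : ((1 - U * Uᵀ) * X + Ub * coeffLeft σ τ U Ub V Vb X * Vᵀ) * V =
      (1 - U * Uᵀ) * (X * V) + Ub * coeffLeft σ τ U Ub V Vb X := by
    rw [Matrix.add_mul, Matrix.mul_assoc _ Vᵀ, h.topV_orth, Matrix.mul_one, Matrix.mul_assoc]
  rw [← e3, Matrix.mul_assoc V, ← Matrix.mul_assoc _ V, e4, ← Matrix.mul_assoc Aᵀ, Matrix.mul_add,
    ← Matrix.mul_assoc Aᵀ (1 - U * Uᵀ), e1, ← Matrix.mul_assoc Aᵀ Ub, e2]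
  simp only [Matrix.mul_add, Matrix.add_mul, Matrix.mul_assoc]

/-- This is the Sylvester equation that determines the off-diagonal block: the derivative of `P K =
K P` with `K = B * Bᵀ`, cut down by `1 - U * Uᵀ` on the left and `U * Uᵀ` on the right. The
coefficients are the solution of the scalar identities `e3`. -/
theorem projDerivBlock_comm (h : BlockSVD A σ τ U Ub V Vb) (hσ : ∀ i, σ i ≠ 0)
    (hgap : ∀ i j, σ i ^ 2 - τ j ^ 2 ≠ 0) (X : Matrix p q ℝ) :
    projDerivBlock σ τ U Ub V Vb X * (A * Aᵀ) - A * Aᵀ * projDerivBlock σ τ U Ub V Vb X =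
      (1 - U * Uᵀ) * (X * Aᵀ + A * Xᵀ) * (U * Uᵀ) := by
  have e1 : V * Vᵀ * Aᵀ = Aᵀ * (U * Uᵀ) := h.transpose.proj_mul.trans h.transpose.mul_proj.symm
  have e2 : Vᵀ * Aᵀ = diagonal σ * Uᵀ := h.transpose.transpose_topU_mul
  have e3 : coeffLeft σ τ U Ub V Vb X * diagonal σ -
      diagonal τ * coeffRight σ τ U Ub V Vb X = diagonal τ * (Vbᵀ * Xᵀ * U) := by
    have : Vbᵀ * Xᵀ * U = (Uᵀ * X * Vb)ᵀ := by simp [Matrix.mul_assoc]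
    rw [this]
    ext j i
    rw [Matrix.sub_apply, mul_diagonal, diagonal_mul, diagonal_mul]
    simp only [coeffLeft, coeffRight, LinearMap.coe_mk, AddHom.coe_mk, of_apply, transpose_apply]
    have := hgap i j
    field_simp
    ring
  rw [← Matrix.mul_assoc, h.projDerivBlock_mul hσ, Matrix.mul_assoc A,
    h.transpose_mul_projDerivBlock hσ hgap, Matrix.mul_assoc Vb, ← Matrix.mul_assoc A, h.mul_botV,
    Matrix.add_mul, Matrix.mul_assoc _ (V * Vᵀ), e1, Matrix.mul_assoc _ Vᵀ, e2, Matrix.mul_add,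
    Matrix.add_mul, ← Matrix.mul_assoc _ A, h.one_sub_proj_mul]
  have e4 := congrArg (fun M => Ub * M * Uᵀ) e3
  simp only [Matrix.mul_sub, Matrix.sub_mul, Matrix.mul_assoc] at e4
  simp only [Matrix.mul_assoc, add_sub_assoc, e4]

theorem linearizedEqs_projDeriv (h : BlockSVD A σ τ U Ub V Vb) (hσ : ∀ i, σ i ≠ 0)
    (hgap : ∀ i j, σ i ^ 2 - τ j ^ 2 ≠ 0) (X : Matrix p q ℝ) :
    linearizedEqs (U * Uᵀ) (A * Aᵀ)
      (projDerivBlock σ τ U Ub V Vb X + (projDerivBlock σ τ U Ub V Vb X)ᵀ) =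
      (0, (X * Aᵀ + A * Xᵀ) * (U * Uᵀ) - U * Uᵀ * (X * Aᵀ + A * Xᵀ), 0) := by
  have h1 := h.proj_mul_projDerivBlock X
  have h2 := h.projDerivBlock_mul_proj X
  have h3 := h.projDerivBlock_comm hσ hgap X
  set N := projDerivBlock σ τ U Ub V Vb X
  have h1' : Nᵀ * (U * Uᵀ) = 0 := by simpa using congrArg Matrix.transpose h1
  have h2' : U * Uᵀ * Nᵀ = Nᵀ := by simpa using congrArg Matrix.transpose h2
  have h3' := congrArg Matrix.transpose h3
  simp only [transpose_sub, transpose_mul, transpose_transpose, transpose_add,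
    transpose_one] at h3'
  refine Prod.ext ?_ (Prod.ext ?_ ?_)
  · change N + Nᵀ - U * Uᵀ * (N + Nᵀ) - (N + Nᵀ) * (U * Uᵀ) = 0
    rw [Matrix.mul_add, Matrix.add_mul, h1, h2, h1', h2']
    abel
  · change (N + Nᵀ) * (A * Aᵀ) - A * Aᵀ * (N + Nᵀ) =
      (X * Aᵀ + A * Xᵀ) * (U * Uᵀ) - U * Uᵀ * (X * Aᵀ + A * Xᵀ)
    have e : (N + Nᵀ) * (A * Aᵀ) - A * Aᵀ * (N + Nᵀ) =
        (N * (A * Aᵀ) - A * Aᵀ * N) - (A * Aᵀ * Nᵀ - Nᵀ * (A * Aᵀ)) := by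
      rw [Matrix.mul_add, Matrix.add_mul]; abel
    rw [e, h3, h3']
    rw [add_comm (A * Xᵀ)]
    set M := X * Aᵀ + A * Xᵀ
    simp only [Matrix.sub_mul, Matrix.mul_sub, Matrix.one_mul, Matrix.mul_one, Matrix.mul_assoc]
    abel
  · change N + Nᵀ - (N + Nᵀ)ᵀ = 0
    rw [transpose_add, transpose_transpose]
    abel

end BlockSVD

end Derivative

end FixedRank

namespace FixedRank

/-! ### Differentiability of the singular projection and of the truncation. -/

section Differentiability

variable {p q ι κ : Type*} [Fintype p] [Fintype q] [Fintype ι] [Fintype κ]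
  [DecidableEq ι] [DecidableEq κ]
  {A : Matrix p q ℝ} {σ : ι → ℝ} {τ : κ → ℝ}
  {U : Matrix p ι ℝ} {Ub : Matrix p κ ℝ} {V : Matrix q ι ℝ} {Vb : Matrix q κ ℝ}

/-- An exact expansion: beyond the first-order term in `K - K₀`, everything is quadratic in the
increments. -/
theorem linearizedEqs_sub {P P₀ K K₀ : Matrix p p ℝ} (hP : IsOrthProj P) (hP₀ : IsOrthProj P₀)
    (hK : P * K = K * P) (hK₀ : P₀ * K₀ = K₀ * P₀) :
    linearizedEqs P₀ K₀ (P - P₀) = ((P - P₀) * (P - P₀),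
      (K - K₀) * P₀ - P₀ * (K - K₀) + ((K - K₀) * (P - P₀) - (P - P₀) * (K - K₀)), 0) := by
  refine Prod.ext ?_ (Prod.ext ?_ ?_)
  · change P - P₀ - P₀ * (P - P₀) - (P - P₀) * P₀ = (P - P₀) * (P - P₀)
    simp only [Matrix.mul_sub, Matrix.sub_mul, hP.idem, hP₀.idem]
    abel
  · change (P - P₀) * K₀ - K₀ * (P - P₀) =
      (K - K₀) * P₀ - P₀ * (K - K₀) + ((K - K₀) * (P - P₀) - (P - P₀) * (K - K₀))
    simp only [Matrix.mul_sub, Matrix.sub_mul, hK, hK₀]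
    abel
  · change P - P₀ - (P - P₀)ᵀ = 0
    rw [transpose_sub, hP.symm, hP₀.symm, sub_self]

theorem BlockSVD.isLittleO_proj [DecidableEq p] (h : BlockSVD A σ τ U Ub V Vb) (hσ : ∀ i, σ i ≠ 0)
    (hgap : ∀ i j, σ i ^ 2 - τ j ^ 2 ≠ 0) {P : Matrix p q ℝ → Matrix p p ℝ}
    (hP : ∀ᶠ B in 𝓝 A, IsOrthProj (P B) ∧ P B * (B * Bᵀ) = B * Bᵀ * P B)
    (hlim : Tendsto P (𝓝 A) (𝓝 (U * Uᵀ))) :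
    (fun B => P B - U * Uᵀ - (projDerivBlock σ τ U Ub V Vb (B - A) +
      (projDerivBlock σ τ U Ub V Vb (B - A))ᵀ)) =o[𝓝 A] fun B => B - A := by
  -- Injectivity in finite dimension bounds `‖w‖` by a multiple of the norm of its image.
  obtain ⟨K, -, hK⟩ := LinearMap.exists_antilipschitzWith _ (h.ker_linearizedEqs hσ hgap)
  set P₀ := U * Uᵀ
  set L : Matrix p q ℝ → Matrix p p ℝ := fun X => projDerivBlock σ τ U Ub V Vb X +
      (projDerivBlock σ τ U Ub V Vb X)ᵀ with hL
  set w : Matrix p q ℝ → Matrix p p ℝ := fun B => P B - P₀ - L (B - A) with hw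
  -- A Lipschitz bound on `P` is not yet known, so errors are measured against a gauge that includes
  -- the unknown remainder `w`; it is absorbed at the end.
  set φ : Matrix p q ℝ → ℝ := fun B => ‖w B‖ + ‖B - A‖ with hφ
  have hXT0 : Tendsto (fun B : Matrix p q ℝ => (B - A)ᵀ) (𝓝 A) (𝓝 0) := by
    have hc : Continuous fun B : Matrix p q ℝ => (B - A)ᵀ :=
      (continuous_id.sub continuous_const).matrix_transpose
    simpa using hc.tendsto A
  have hd0 : Tendsto (fun B => P B - P₀) (𝓝 A) (𝓝 0) := by
    simpa using hlim.sub_const P₀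
  have hK0 : Tendsto (fun B : Matrix p q ℝ => B * Bᵀ - A * Aᵀ) (𝓝 A) (𝓝 0) := by
    have hc : Continuous fun B : Matrix p q ℝ => B * Bᵀ - A * Aᵀ :=
      (continuous_id.matrix_mul continuous_id.matrix_transpose).sub continuous_const
    simpa using hc.tendsto A
  have hXφ : (fun B : Matrix p q ℝ => B - A) =O[𝓝 A] φ :=
    Asymptotics.isBigO_of_le _ fun B => by
      rw [hφ, Real.norm_of_nonneg (by positivity)]
      linarith [norm_nonneg (w B)]
  have hwφ : w =O[𝓝 A] φ :=
    Asymptotics.isBigO_of_le _ fun B => by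
      rw [hφ, Real.norm_of_nonneg (by positivity)]
      linarith [norm_nonneg (B - A)]
  have hLX : (fun B => L (B - A)) =O[𝓝 A] fun B => B - A := by
    have h1 : (fun B => projDerivBlock σ τ U Ub V Vb (B - A)) =O[𝓝 A] fun B => B - A :=
      (LinearMap.toContinuousLinearMap (projDerivBlock σ τ U Ub V Vb)).isBigO_comp _ _
    refine h1.add ((Asymptotics.isBigO_of_le _ fun B => ?_).trans h1)
    rw [frobenius_norm_transpose]
  have hdφ : (fun B => P B - P₀) =O[𝓝 A] φ := by
    have := hwφ.add (hLX.trans hXφ)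
    simpa [hw] using this
  have hQ : (fun B : Matrix p q ℝ => (B - A) * (B - A)ᵀ) =o[𝓝 A] φ :=
    isLittleO_mul_of_tendsto_right hXφ hXT0
  have key : (fun B => linearizedEqs P₀ (A * Aᵀ) (w B)) =o[𝓝 A] φ := by
    have e : (fun B => linearizedEqs P₀ (A * Aᵀ) (w B)) =ᶠ[𝓝 A] fun B =>
        ((P B - P₀) * (P B - P₀),
          (B - A) * (B - A)ᵀ * P₀ - P₀ * ((B - A) * (B - A)ᵀ) +
          ((B * Bᵀ - A * Aᵀ) * (P B - P₀) - (P B - P₀) * (B * Bᵀ - A * Aᵀ)), 0) := by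
      filter_upwards [hP] with B hB
      rw [hw, map_sub, linearizedEqs_sub hB.1 h.isOrthProj hB.2 h.proj_comm, hL,
        h.linearizedEqs_projDeriv hσ hgap]
      refine Prod.ext (sub_zero _) (Prod.ext ?_ (sub_zero _))
      have e1 : B * Bᵀ - A * Aᵀ =
          ((B - A) * Aᵀ + A * (B - A)ᵀ) + (B - A) * (B - A)ᵀ := by
        simp only [transpose_sub, Matrix.mul_sub, Matrix.sub_mul]
        abel
      change (B * Bᵀ - A * Aᵀ) * P₀ - P₀ * (B * Bᵀ - A * Aᵀ) + _ -
        (((B - A) * Aᵀ + A * (B - A)ᵀ) * P₀ - P₀ * ((B - A) * Aᵀ + A * (B - A)ᵀ)) = _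
      generalize ((B * Bᵀ - A * Aᵀ) * (P B - P₀) - (P B - P₀) * (B * Bᵀ - A * Aᵀ)) = Y
      rw [e1]
      generalize (B - A) * Aᵀ + A * (B - A)ᵀ = M
      generalize (B - A) * (B - A)ᵀ = M'
      rw [Matrix.add_mul, Matrix.mul_add]
      abel_nf
    refine Asymptotics.IsLittleO.congr' ?_ e.symm EventuallyEq.rfl
    refine (isLittleO_mul_of_tendsto hd0 hdφ).prod_left (Asymptotics.IsLittleO.prod_left ?_
      (Asymptotics.isLittleO_zero _ _))
    exact (((isBigO_mul_const _ _).trans_isLittleO hQ).sub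
      ((isBigO_const_mul _ _).trans_isLittleO hQ)).add
      ((isLittleO_mul_of_tendsto hK0 hdφ).sub (isLittleO_mul_of_tendsto_right hdφ hK0))
  have hwo : w =o[𝓝 A] φ :=
    (Asymptotics.IsBigO.of_bound K (Eventually.of_forall fun B =>
      hK.le_mul_norm (map_zero _) (w B))).trans_isLittleO key
  rw [Asymptotics.isLittleO_iff]
  intro c hc
  -- With this constant, `‖w‖ ≤ ‖w‖ / 2 + (c / 2) * ‖B - A‖`, hence `‖w‖ ≤ c * ‖B - A‖`.
  have hc' : 0 < min (1 / 2) (c / 2) := by positivity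
  filter_upwards [hwo.def hc'] with B hB
  rw [hφ, Real.norm_of_nonneg (by positivity)] at hB
  have h1 : min (1 / 2) (c / 2) * ‖w B‖ ≤ 1 / 2 * ‖w B‖ :=
    mul_le_mul_of_nonneg_right (min_le_left _ _) (norm_nonneg _)
  have h2 : min (1 / 2) (c / 2) * ‖B - A‖ ≤ c / 2 * ‖B - A‖ :=
    mul_le_mul_of_nonneg_right (min_le_right _ _) (norm_nonneg _)
  change ‖w B‖ ≤ _
  linarith

/-- Product rule: with `L = N + Nᵀ`, the remainder is `(P B - U * Uᵀ - L) * A + (P B - U * Uᵀ) * (B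
- A)`. The second term needs only continuity of `P` at `A`. -/
theorem BlockSVD.hasFDerivAt_truncation [DecidableEq p]
    (h : BlockSVD A σ τ U Ub V Vb) (hσ : ∀ i, σ i ≠ 0)
    (hgap : ∀ i j, σ i ^ 2 - τ j ^ 2 ≠ 0) {P : Matrix p q ℝ → Matrix p p ℝ}
    (hP : ∀ᶠ B in 𝓝 A, IsOrthProj (P B) ∧ P B * (B * Bᵀ) = B * Bᵀ * P B)
    (hlim : Tendsto P (𝓝 A) (𝓝 (U * Uᵀ))) {f : Matrix p q ℝ → Matrix p q ℝ}
    (hf : ∀ᶠ B in 𝓝 A, f B = P B * B) (hfA : f A = U * Uᵀ * A) :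
    HasFDerivAt f (LinearMap.toContinuousLinearMap (truncationDeriv σ τ U Ub V Vb)) A := by
  refine HasFDerivAt.of_isLittleO ?_
  have hd0 : Tendsto (fun B => P B - U * Uᵀ) (𝓝 A) (𝓝 0) := by
    simpa using hlim.sub_const (U * Uᵀ)
  have h1 := (isBigO_mul_const (fun B => P B - U * Uᵀ - (projDerivBlock σ τ U Ub V Vb (B - A) +
      (projDerivBlock σ τ U Ub V Vb (B - A))ᵀ)) A).trans_isLittleO
      (h.isLittleO_proj hσ hgap hP hlim)
  have h2 : (fun B => (P B - U * Uᵀ) * (B - A)) =o[𝓝 A] fun B => B - A :=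
    (isLittleO_mul_of_tendsto hd0 (Asymptotics.isBigO_refl _ _).norm_right).of_norm_right
  refine (h1.add h2).congr' ?_ EventuallyEq.rfl
  filter_upwards [hf] with B hB
  have e1 := h.projDerivBlock_mul hσ (B - A)
  have e2 : (projDerivBlock σ τ U Ub V Vb (B - A))ᵀ * A =
      U * (coeffRight σ τ U Ub V Vb (B - A))ᵀ * Vbᵀ := by
    have := congrArg Matrix.transpose (h.transpose_mul_projDerivBlock hσ hgap (B - A))
    simpa [Matrix.mul_assoc] using this
  change _ = f B - f A - ((1 - U * Uᵀ) * (B - A) * (V * Vᵀ) + U * Uᵀ * (B - A) +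
    (Ub * coeffLeft σ τ U Ub V Vb (B - A) * Vᵀ +
      U * (coeffRight σ τ U Ub V Vb (B - A))ᵀ * Vbᵀ))
  rw [hB, hfA, Matrix.sub_mul (P B - U * Uᵀ), Matrix.add_mul (projDerivBlock σ τ U Ub V Vb (B - A)),
    e1, e2, Matrix.sub_mul (P B), Matrix.sub_mul (P B), Matrix.mul_sub (P B),
    Matrix.mul_sub (U * Uᵀ)]
  abel

end Differentiability

end FixedRank

namespace FixedRank

/-! ### The tangent space and the orthogonal projection onto it. -/

section Tangent

variable {l m r k : ℕ} {κ : Type*} [Fintype κ] [DecidableEq κ]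
  {A : Matrix (Fin l) (Fin m) ℝ} {σ : Fin r → ℝ} {τ : κ → ℝ} {U : Matrix (Fin l) (Fin r) ℝ}
  {Ub : Matrix (Fin l) κ ℝ} {V : Matrix (Fin m) (Fin r) ℝ} {Vb : Matrix (Fin m) κ ℝ}

/-- With its second block empty, the perturbation results apply at the truncation with `t = 0`. -/
theorem BlockSVD.truncation (h : BlockSVD A σ τ U Ub V Vb) :
    BlockSVD (U * Uᵀ * A) σ (0 : Fin 0 → ℝ) U 0 V 0 :=
  ⟨h.topU_orth, by simp, by ext i; exact i.elim0, h.topV_orth, by simp, by ext i; exact i.elim0, by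
    simp [h.proj_mul]⟩

/-- The map `Y ↦ M * Y * N`. -/
noncomputable def mulLeftRight (M : Matrix (Fin l) (Fin l) ℝ) (N : Matrix (Fin m) (Fin m) ℝ) :
    Matrix (Fin l) (Fin m) ℝ →L[ℝ] Matrix (Fin l) (Fin m) ℝ :=
  LinearMap.toContinuousLinearMap
    { toFun := fun Y => M * Y * N
      map_add' := fun X Y => by rw [Matrix.mul_add, Matrix.add_mul]
      map_smul' := fun c X => by simp }

theorem mulLeftRight_apply (M : Matrix (Fin l) (Fin l) ℝ) (N : Matrix (Fin m) (Fin m) ℝ)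
    (Y : Matrix (Fin l) (Fin m) ℝ) : mulLeftRight M N Y = M * Y * N := rfl

theorem BlockSVD.tangentSpace_subset (hr : 0 < r) (h : BlockSVD A σ τ U Ub V Vb)
    {s : ℝ} (hs0 : 0 < s) (hs : ∀ i, s ≤ σ i ^ 2) :
    tangentSpace (fixedRank l m r) (U * Uᵀ * A) ⊆
      {Y | (1 - U * Uᵀ) * Y * (1 - V * Vᵀ) = 0} := by
  rintro X ⟨ε, γ, hε, -, hγ, hγ0, hX⟩
  have h0 := h.truncation
  set R := U * Uᵀ * A
  have hRQ : R * (1 - V * Vᵀ) = 0 := by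
    rw [Matrix.mul_sub, h0.mul_proj, ← h0.proj_mul]
    simp only [R]
    rw [← Matrix.mul_assoc, h.isOrthProj.idem, Matrix.mul_one, sub_self]
  have hγc : Tendsto (fun t => ‖γ t - R‖) (𝓝 0) (𝓝 0) := by
    have h1 : Tendsto γ (𝓝 0) (𝓝 R) := hγ0 ▸ hX.continuousAt.tendsto
    simpa using (h1.sub_const R).norm
  have hbound : ∀ᶠ t in 𝓝 (0 : ℝ), ‖mulLeftRight (1 - U * Uᵀ) (1 - V * Vᵀ) (γ t)‖ ≤
      √(8 * ‖R‖ * ‖γ t - R‖ / s) * ‖γ t - R‖ * ‖1 - V * Vᵀ‖ := by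
    have hsmall : ∀ᶠ t in 𝓝 (0 : ℝ), 32 * ‖R‖ * ‖γ t - R‖ < s - 0 := by
      have := hγc.const_mul (32 * ‖R‖)
      rw [mul_zero] at this
      exact this.eventually (gt_mem_nhds (by simpa using hs0))
    filter_upwards [hsmall, Ioo_mem_nhds (neg_lt_zero.2 hε) hε] with t ht htε
    obtain ⟨n, ρ, u, v, hsvd⟩ := exists_isSVD (γ t)
    obtain ⟨P, -, -, hPn, -, -, huniq⟩ := h0.truncated_of_near hr hs (t := 0)
      (fun j => j.elim0) le_rfl hs0 ht hsvd
    -- A matrix of rank `r` is its own nearest point.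
    have hPγ : γ t = P * γ t := huniq _ ⟨hγ t htε, fun z _ => by simp⟩
    -- A product of an `o(1)` factor and an `O(t)` factor, so the normal component of the velocity
    -- vanishes.
    have e : (1 - U * Uᵀ) * γ t * (1 - V * Vᵀ) = (P - U * Uᵀ) * (γ t - R) * (1 - V * Vᵀ) := by
      rw [Matrix.mul_sub (P - U * Uᵀ), Matrix.sub_mul ((P - U * Uᵀ) * γ t), Matrix.mul_assoc _ R,
        hRQ, Matrix.mul_zero, sub_zero, Matrix.sub_mul 1, Matrix.sub_mul P, ← hPγ, Matrix.one_mul]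
    have hP : ‖P - U * Uᵀ‖ ≤ √(8 * ‖R‖ * ‖γ t - R‖ / s) := by
      apply Real.le_sqrt_of_sq_le
      rw [le_div_iff₀ hs0]
      rw [sub_zero] at hPn
      linarith
    rw [mulLeftRight_apply, e]
    refine (frobenius_norm_mul _ _).trans (mul_le_mul_of_nonneg_right ?_ (norm_nonneg _))
    exact (frobenius_norm_mul _ _).trans (mul_le_mul_of_nonneg_right hP (norm_nonneg _))
  have hd : HasDerivAt (fun t => mulLeftRight (1 - U * Uᵀ) (1 - V * Vᵀ) (γ t))
      (mulLeftRight (1 - U * Uᵀ) (1 - V * Vᵀ) X) 0 :=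
    (mulLeftRight (1 - U * Uᵀ) (1 - V * Vᵀ)).hasFDerivAt.comp_hasDerivAt 0 hX
  have hz : HasDerivAt (fun t => mulLeftRight (1 - U * Uᵀ) (1 - V * Vᵀ) (γ t)) 0 0 := by
    refine hasDerivAt_iff_isLittleO.2 ?_
    have e0 : mulLeftRight (1 - U * Uᵀ) (1 - V * Vᵀ) (γ 0) = 0 := by
      rw [mulLeftRight_apply, hγ0, Matrix.mul_assoc, hRQ, Matrix.mul_zero]
    simp only [e0, smul_zero, sub_zero]
    have hO : (fun t => ‖γ t - R‖) =O[𝓝 0] fun t : ℝ => t := by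
      have := hX.isBigO_sub
      simpa [hγ0] using this.norm_left
    have ho : (fun t => √(8 * ‖R‖ * ‖γ t - R‖ / s)) =o[𝓝 0] fun _ => (1 : ℝ) := by
      rw [Asymptotics.isLittleO_one_iff]
      have := ((hγc.const_mul (8 * ‖R‖)).div_const s).sqrt
      simpa using this
    have hoo : (fun t => √(8 * ‖R‖ * ‖γ t - R‖ / s) * ‖γ t - R‖ * ‖1 - V * Vᵀ‖)
        =o[𝓝 0] fun t : ℝ => t :=
      ((ho.mul_isBigO hO).mul_isBigO
        (Asymptotics.isBigO_refl (fun _ => ‖1 - V * Vᵀ‖) (𝓝 0))).trans_isBigO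
        (Asymptotics.IsBigO.of_bound ‖1 - V * Vᵀ‖
          (Eventually.of_forall fun t => by simp [mul_comm]))
    refine (Asymptotics.IsBigO.of_bound 1 ?_).trans_isLittleO hoo
    filter_upwards [hbound] with t ht
    rw [one_mul, Real.norm_of_nonneg (by positivity)]
    exact ht
  exact hd.unique hz

theorem BlockSVD.subset_tangentSpace (h : BlockSVD A σ τ U Ub V Vb) (hσ : ∀ i, σ i ≠ 0) :
    {Y | (1 - U * Uᵀ) * Y * (1 - V * Vᵀ) = 0} ⊆
      tangentSpace (fixedRank l m r) (U * Uᵀ * A) := by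
  intro Y hY
  have h0 := h.truncation
  have hrank : (U * Uᵀ * A).rank = r := by
    rw [h.proj_mul, rank_mul_diagonal_mul_transpose h.topU_orth h.topV_orth hσ, Fintype.card_fin]
  set R := U * Uᵀ * A with hR
  set G := V * diagonal (fun i => (σ i)⁻¹) * Uᵀ
  have hGR : G * R = V * Vᵀ := h0.pinv_mul hσ
  have hRG : R * G = U * Uᵀ := h0.mul_pinv hσ
  -- `G` is the pseudo-inverse of `R`. These choices split `Y` as `W * R + R * W'`, so `Y` is the
  -- velocity of `(1 + t • W) * R * (1 + t • W')`, whose rank is constant while the outer factors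
  -- are invertible.
  set W := Y * G
  set W' := G * Y * (1 - V * Vᵀ)
  have hWY : W * R + R * W' = Y := by
    have e : W * R + R * W' = Y - (1 - U * Uᵀ) * Y * (1 - V * Vᵀ) := by
      simp only [W, W']
      rw [Matrix.mul_assoc Y, hGR, ← Matrix.mul_assoc R, ← Matrix.mul_assoc R G, hRG]
      simp only [Matrix.mul_sub, Matrix.sub_mul, Matrix.one_mul, Matrix.mul_one]
      abel
    rw [e, hY, sub_zero]
  have hdet : ∀ {n : ℕ} (M : Matrix (Fin n) (Fin n) ℝ),
      ∀ᶠ t in 𝓝 (0 : ℝ), (1 + t • M).det ≠ 0 := fun M => by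
    have hc : Continuous fun t : ℝ => (1 + t • M).det := by fun_prop
    have := hc.tendsto 0
    simp only [zero_smul, add_zero, det_one] at this
    exact this.eventually (isOpen_ne.mem_nhds one_ne_zero)
  obtain ⟨ε, hε, hball⟩ := Metric.eventually_nhds_iff_ball.1 ((hdet W).and (hdet W'))
  rw [Real.ball_eq_Ioo, zero_sub, zero_add] at hball
  have hexp : ∀ t : ℝ, (1 + t • W) * R * (1 + t • W') =
      R + t • (W * R + R * W') + (t ^ 2) • (W * R * W') := fun t => by
    simp only [Matrix.add_mul, Matrix.mul_add, Matrix.one_mul, Matrix.mul_one, Matrix.smul_mul,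
      Matrix.mul_smul, smul_add, smul_smul, sq]
    abel
  refine ⟨ε, fun t => (1 + t • W) * R * (1 + t • W'), hε, ?_, fun t ht => ?_, by simp, ?_⟩
  · simp only [hexp]
    exact ((contDiff_const.add (contDiff_id.smul contDiff_const)).add
      ((contDiff_id.pow 2).smul contDiff_const)).contDiffOn
  · change ((1 + t • W) * R * (1 + t • W')).rank = r
    rw [rank_mul_eq_left_of_det_ne_zero _ _ (hball t ht).2,
      rank_mul_eq_right_of_det_ne_zero _ _ (hball t ht).1, hrank]
  · simp only [hexp, hWY]
    have h1 := ((hasDerivAt_id (0 : ℝ)).smul_const Y).const_add R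
    have h2 := ((hasDerivAt_id (0 : ℝ)).pow 2).smul_const (W * R * W')
    have h3 := h1.add h2
    simp only [id, one_smul, Nat.cast_ofNat, Nat.add_one_sub_one, pow_one, mul_zero, zero_mul,
      zero_smul, add_zero] at h3
    exact h3

/-- The orthogonal projection onto the tangent space of the manifold of matrices of rank `r`. -/
theorem BlockSVD.orthProj_tangentSpace (hr : 0 < r) (h : BlockSVD A σ τ U Ub V Vb)
    {s : ℝ} (hs0 : 0 < s) (hs : ∀ i, s ≤ σ i ^ 2) (X : Matrix (Fin l) (Fin m) ℝ) :
    orthProj (tangentSpace (fixedRank l m r) (U * Uᵀ * A)) X =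
      (1 - U * Uᵀ) * X * (V * Vᵀ) + U * Uᵀ * X := by
  have hσ : ∀ i, σ i ≠ 0 := fun i hi => by
    have := hs i
    rw [hi] at this
    norm_num at this
    linarith
  rw [(h.tangentSpace_subset hr hs0 hs).antisymm (h.subset_tangentSpace hσ)]
  set N := (1 - U * Uᵀ) * X * (1 - V * Vᵀ) with hN
  have hP := h.isOrthProj.one_sub
  have hQ := h.transpose.isOrthProj.one_sub
  have hXN : (1 - U * Uᵀ) * X * (V * Vᵀ) + U * Uᵀ * X = X - N := by
    simp only [hN, Matrix.mul_sub, Matrix.sub_mul, Matrix.one_mul, Matrix.mul_one]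
    abel
  rw [hXN]
  have hmem : X - N ∈ {Y | (1 - U * Uᵀ) * Y * (1 - V * Vᵀ) = 0} := by
    change (1 - U * Uᵀ) * (X - N) * (1 - V * Vᵀ) = 0
    have e : (1 - U * Uᵀ) * N * (1 - V * Vᵀ) = N := by
      rw [hN, Matrix.mul_assoc, Matrix.mul_assoc, hQ.idem, ← Matrix.mul_assoc, ← Matrix.mul_assoc,
        hP.idem]
    rw [Matrix.mul_sub (1 - U * Uᵀ), Matrix.sub_mul ((1 - U * Uᵀ) * X), e, hN, sub_self]
  -- Pythagoras: `N` is orthogonal to every matrix in this kernel.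
  have key : ∀ z ∈ {Y | (1 - U * Uᵀ) * Y * (1 - V * Vᵀ) = 0},
      ‖X - z‖ ^ 2 = ‖X - (X - N)‖ ^ 2 + ‖X - N - z‖ ^ 2 := by
    intro z hz
    have hD : (1 - U * Uᵀ) * (X - N - z) * (1 - V * Vᵀ) = 0 := by
      rw [Matrix.mul_sub (1 - U * Uᵀ), Matrix.sub_mul ((1 - U * Uᵀ) * (X - N)), hmem, hz, sub_self]
    have ho : (Nᵀ * (X - N - z)).trace = 0 := by
      have e : Nᵀ = (1 - V * Vᵀ) * (Xᵀ * (1 - U * Uᵀ)) := by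
        rw [hN, transpose_mul, transpose_mul, hP.symm, hQ.symm]
      rw [e, Matrix.mul_assoc, trace_mul_comm, Matrix.mul_assoc, Matrix.mul_assoc,
        ← Matrix.mul_assoc (1 - U * Uᵀ), hD]
      simp
    have ho' : ((X - N - z)ᵀ * N).trace = 0 := by
      rw [← trace_transpose, transpose_mul, transpose_transpose, ho]
    have e : X - z = N + (X - N - z) := by abel
    rw [e, sub_sub_cancel]
    simp only [norm_sq_eq_trace]
    rw [transpose_add, Matrix.mul_add, Matrix.add_mul, Matrix.add_mul, trace_add, trace_add,
      trace_add, ho, ho']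
    ring
  refine orthProj_eq ⟨hmem, fun z hz => ?_⟩ fun z hz => ?_
  · exact le_of_sq_le_sq (by nlinarith [key z hz, sq_nonneg ‖X - N - z‖]) (norm_nonneg _)
  · have h1 := pow_le_pow_left₀ (norm_nonneg _) (hz.2 _ hmem) 2
    have h2 : ‖X - N - z‖ ^ 2 = 0 := le_antisymm (by linarith [key z hz.1]) (sq_nonneg _)
    have h3 := norm_eq_zero.1 (pow_eq_zero_iff two_ne_zero |>.1 h2)
    exact (sub_eq_zero.1 h3).symm

/-- The projections attached to an orthonormal factorization of the truncation. -/
theorem BlockSVD.proj_eq_of_factorization (h : BlockSVD A σ τ U Ub V Vb) (hσ : ∀ i, σ i ≠ 0)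
    {Y : Matrix (Fin l) (Fin r) ℝ} {Z : Matrix (Fin m) (Fin r) ℝ} (hY : Yᵀ * Y = 1)
    (hZ : Z.rank = r) (hYZ : U * Uᵀ * A = Y * Zᵀ) :
    Y * Yᵀ = U * Uᵀ ∧ Z * (Zᵀ * Z)⁻¹ * Zᵀ = V * Vᵀ := by
  have h0 := h.truncation
  have hdet : IsUnit (Zᵀ * Z).det := by
    rw [← isUnit_iff_isUnit_det, ← mulVec_surjective_iff_isUnit]
    refine (LinearMap.range_eq_top (f := (Zᵀ * Z).mulVecLin)).1
      (Submodule.eq_top_of_finrank_eq ?_)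
    change (Zᵀ * Z).rank = _
    rw [rank_transpose_mul_self, hZ, Module.finrank_fin_fun]
  set R := U * Uᵀ * A with hR
  set G := V * diagonal (fun i => (σ i)⁻¹) * Uᵀ
  have hGR : G * R = V * Vᵀ := h0.pinv_mul hσ
  have hRG : R * G = U * Uᵀ := h0.mul_pinv hσ
  have hPR : U * Uᵀ * R = R := by rw [hR, ← Matrix.mul_assoc, h.isOrthProj.idem]
  have hRQ : R * (V * Vᵀ) = R := by rw [h0.mul_proj, ← h0.proj_mul, hPR]
  constructor
  · have hYR : Y * Yᵀ * R = R := by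
      rw [hYZ, Matrix.mul_assoc, ← Matrix.mul_assoc Yᵀ, hY, Matrix.one_mul]
    have h1 : Y * Yᵀ * (U * Uᵀ) = U * Uᵀ := by rw [← hRG, ← Matrix.mul_assoc, hYR]
    have hYe : Y = R * (Z * (Zᵀ * Z)⁻¹) := by
      rw [hYZ, Matrix.mul_assoc, ← Matrix.mul_assoc Zᵀ, mul_nonsing_inv _ hdet, Matrix.mul_one]
    have h2 : U * Uᵀ * (Y * Yᵀ) = Y * Yᵀ := by
      rw [← Matrix.mul_assoc]
      congr 1
      rw [hYe, ← Matrix.mul_assoc, hPR]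
    have h3 := congrArg Matrix.transpose h1
    simp only [transpose_mul, transpose_transpose] at h3
    rw [← h2, h3]
  · set Q := Z * (Zᵀ * Z)⁻¹ * Zᵀ with hQ
    have hQs : Qᵀ = Q := by
      rw [hQ, transpose_mul, transpose_mul, transpose_nonsing_inv, transpose_mul,
        transpose_transpose, Matrix.mul_assoc]
    have hRQ' : R * Q = R := by
      rw [hYZ, hQ, Matrix.mul_assoc, ← Matrix.mul_assoc Zᵀ, ← Matrix.mul_assoc Zᵀ,
        mul_nonsing_inv _ hdet, Matrix.one_mul]
    have h1 : V * Vᵀ * Q = V * Vᵀ := by rw [← hGR, Matrix.mul_assoc, hRQ']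
    have hZe : Zᵀ = Yᵀ * R := by rw [hYZ, ← Matrix.mul_assoc, hY, Matrix.one_mul]
    have h2 : Q * (V * Vᵀ) = Q := by
      rw [hQ, Matrix.mul_assoc _ Zᵀ]
      congr 1
      rw [hZe, Matrix.mul_assoc, hRQ]
    have h3 := congrArg Matrix.transpose h2
    rw [transpose_mul, transpose_mul V, transpose_transpose, hQs] at h3
    rw [← h3, h1]

end Tangent

end FixedRank

namespace FixedRank

/-! ### Matrix form of the derivative against its expansion in singular vectors. -/

section Formulas

variable {l m r k : ℕ}

theorem colMatrix_mul_mul_transpose (w : Fin k → Fin l → ℝ) (z : Fin r → Fin m → ℝ)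
    (C : Matrix (Fin k) (Fin r) ℝ) :
    colMatrix w * C * (colMatrix z)ᵀ = ∑ i, ∑ j, C j i • vecMulVec (w j) (z i) := by
  ext a b
  simp only [Matrix.sum_apply, Matrix.smul_apply, vecMulVec_apply, smul_eq_mul]
  rw [mul_apply]
  refine Finset.sum_congr rfl fun i _ => ?_
  rw [mul_apply, Finset.sum_mul]
  refine Finset.sum_congr rfl fun j _ => ?_
  simp only [colMatrix, transpose_apply, of_apply]
  ring

theorem colMatrix_transpose_mul_mul (w : Fin k → Fin l → ℝ) (z : Fin r → Fin m → ℝ)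
    (X : Matrix (Fin l) (Fin m) ℝ) (j : Fin k) (i : Fin r) :
    ((colMatrix w)ᵀ * X * colMatrix z) j i = w j ⬝ᵥ X *ᵥ z i := by
  rw [Matrix.mul_assoc]
  rfl

theorem frobInner_add_right (X A B : Matrix (Fin l) (Fin m) ℝ) :
    frobInner X (A + B) = frobInner X A + frobInner X B := by
  rw [frobInner, Matrix.mul_add, trace_add]; rfl

theorem frobInner_sub_right (X A B : Matrix (Fin l) (Fin m) ℝ) :
    frobInner X (A - B) = frobInner X A - frobInner X B := by
  rw [frobInner, Matrix.mul_sub, trace_sub]; rfl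

theorem frobInner_smul_right (c : ℝ) (X A : Matrix (Fin l) (Fin m) ℝ) :
    frobInner X (c • A) = c * frobInner X A := by
  rw [frobInner, Matrix.mul_smul, trace_smul]; rfl

theorem frobInner_vecMulVec (X : Matrix (Fin l) (Fin m) ℝ) (a : Fin l → ℝ) (b : Fin m → ℝ) :
    frobInner X (vecMulVec a b) = a ⬝ᵥ X *ᵥ b := by
  rw [frobInner, mul_vecMulVec, trace_vecMulVec, mulVec_transpose, dotProduct_mulVec]

/-- The two forms of the curvature term. -/
theorem phi_terms_eq {s t : ℝ} (h1 : s - t ≠ 0) (h2 : s + t ≠ 0) (X : Matrix (Fin l) (Fin m) ℝ)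
    (u u' : Fin l → ℝ) (v v' : Fin m → ℝ) :
    (t / (s - t) * frobInner X (phiPlus u u' v v')) • phiPlus u u' v v' -
      (t / (s + t) * frobInner X (phiMinus u u' v v')) • phiMinus u u' v v' =
    (t / (s ^ 2 - t ^ 2)) • ((t * (u' ⬝ᵥ X *ᵥ v) + s * (u ⬝ᵥ X *ᵥ v')) • vecMulVec u' v +
      (s * (u' ⬝ᵥ X *ᵥ v) + t * (u ⬝ᵥ X *ᵥ v')) • vecMulVec u v') := by
  simp only [phiPlus, phiMinus, frobInner_smul_right, frobInner_add_right, frobInner_sub_right,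
    frobInner_vecMulVec]
  have h3 : s ^ 2 - t ^ 2 ≠ 0 := by
    rw [sq_sub_sq]; exact mul_ne_zero h2 h1
  have hc : (1 / √2) * (1 / √2) = (1 / 2 : ℝ) := by
    rw [div_mul_div_comm, Real.mul_self_sqrt (by norm_num)]; norm_num
  generalize u' ⬝ᵥ X *ᵥ v = α
  generalize u ⬝ᵥ X *ᵥ v' = β
  have e1 : t / (s - t) * (1 / √2 * (α + β)) * (1 / √2) = t / (s - t) * (α + β) / 2 := by
    linear_combination t / (s - t) * (α + β) * hc
  have e2 : t / (s + t) * (1 / √2 * (α - β)) * (1 / √2) = t / (s + t) * (α - β) / 2 := by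
    linear_combination t / (s + t) * (α - β) * hc
  rw [smul_smul, smul_smul, e1, e2]
  ext a b
  simp only [Matrix.sub_apply, Matrix.add_apply, Matrix.smul_apply, smul_eq_mul]
  generalize vecMulVec u' v a b = x
  generalize vecMulVec u v' a b = y
  have e3 : t / (s - t) = t * (s + t) / (s ^ 2 - t ^ 2) := by
    rw [div_eq_div_iff h1 h3]; ring
  have e4 : t / (s + t) = t * (s - t) / (s ^ 2 - t ^ 2) := by
    rw [div_eq_div_iff h2 h3]; ring
  rw [e3, e4]
  ring

theorem truncationDeriv_apply (σ : Fin r → ℝ) (τ : Fin k → ℝ) (u : Fin r → Fin l → ℝ)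
    (u' : Fin k → Fin l → ℝ) (v : Fin r → Fin m → ℝ) (v' : Fin k → Fin m → ℝ)
    (X : Matrix (Fin l) (Fin m) ℝ) :
    truncationDeriv σ τ (colMatrix u) (colMatrix u') (colMatrix v) (colMatrix v') X =
      (1 - colMatrix u * (colMatrix u)ᵀ) * X * (colMatrix v * (colMatrix v)ᵀ) +
      colMatrix u * (colMatrix u)ᵀ * X +
      ∑ i, ∑ j, (τ j / (σ i ^ 2 - τ j ^ 2)) •
        ((τ j * (u' j ⬝ᵥ X *ᵥ v i) + σ i * (u i ⬝ᵥ X *ᵥ v' j)) • vecMulVec (u' j) (v i) +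
          (σ i * (u' j ⬝ᵥ X *ᵥ v i) + τ j * (u i ⬝ᵥ X *ᵥ v' j)) • vecMulVec (u i) (v' j)) := by
  simp only [truncationDeriv, coeffLeft, coeffRight, LinearMap.coe_mk, AddHom.coe_mk,
    colMatrix_mul_mul_transpose, transpose_apply, of_apply, colMatrix_transpose_mul_mul]
  rw [Finset.sum_comm (s := (Finset.univ : Finset (Fin k)))]
  simp only [← Finset.sum_add_distrib, smul_add, smul_smul]

end Formulas

/-! ### A family of projections near `A`, and the assembly of the theorem. -/

/-- The projections near `A` depend continuously on the matrix at `A`. -/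
theorem BlockSVD.exists_proj_family {l m r : ℕ} {κ : Type*} [Fintype κ] [DecidableEq κ]
    {A : Matrix (Fin l) (Fin m) ℝ} {σ : Fin r → ℝ} {τ : κ → ℝ} {U : Matrix (Fin l) (Fin r) ℝ}
    {Ub : Matrix (Fin l) κ ℝ} {V : Matrix (Fin m) (Fin r) ℝ} {Vb : Matrix (Fin m) κ ℝ} {s t : ℝ}
    (hr : 0 < r) (h : BlockSVD A σ τ U Ub V Vb)
    (hs : ∀ i, s ≤ σ i ^ 2) (ht : ∀ j, τ j ^ 2 ≤ t) (ht0 : 0 ≤ t) (hst : t < s) :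
    ∃ P : Matrix (Fin l) (Fin m) ℝ → Matrix (Fin l) (Fin l) ℝ,
      Tendsto P (𝓝 A) (𝓝 (U * Uᵀ)) ∧
      (∀ᶠ B in 𝓝 A, IsOrthProj (P B) ∧ P B * (B * Bᵀ) = B * Bᵀ * P B) ∧
      ∀ᶠ B in 𝓝 A, IsNearest (fixedRank l m r) B (P B * B) ∧
        (∀ R, IsNearest (fixedRank l m r) B R → R = P B * B) ∧
        ∀ T, IsTruncatedSVD r B T ↔ T = P B * B := by
  have hlim : Tendsto (fun B : Matrix (Fin l) (Fin m) ℝ => ‖B - A‖) (𝓝 A) (𝓝 0) := by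
    have hc : Continuous fun B : Matrix (Fin l) (Fin m) ℝ => ‖B - A‖ :=
      (continuous_id.sub continuous_const).norm
    simpa using hc.tendsto A
  have hnear : ∀ᶠ B in 𝓝 A, 32 * ‖A‖ * ‖B - A‖ < s - t := by
    have := hlim.const_mul (32 * ‖A‖)
    rw [mul_zero] at this
    exact this.eventually (gt_mem_nhds (sub_pos.2 hst))
  have hex : ∀ B : Matrix (Fin l) (Fin m) ℝ, ∃ P : Matrix (Fin l) (Fin l) ℝ,
      32 * ‖A‖ * ‖B - A‖ < s - t →
      IsOrthProj P ∧ P * (B * Bᵀ) = B * Bᵀ * P ∧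
      (s - t) * ‖P - U * Uᵀ‖ ^ 2 ≤ 8 * ‖A‖ * ‖B - A‖ ∧
      IsTruncatedSVD r B (P * B) ∧ IsNearest (fixedRank l m r) B (P * B) ∧
      ∀ R, IsNearest (fixedRank l m r) B R → R = P * B := fun B => by
    by_cases hB : 32 * ‖A‖ * ‖B - A‖ < s - t
    · obtain ⟨n, ρ, u, v, hsvd⟩ := exists_isSVD B
      obtain ⟨P, h1, h2, h3, h4, h5⟩ := h.truncated_of_near hr hs ht ht0 hst hB hsvd
      exact ⟨P, fun _ => ⟨h1, h2, h3, ⟨n, ρ, u, v, hsvd, h4.symm⟩, h5⟩⟩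
    -- An arbitrary value away from `A`, where nothing is claimed.
    · exact ⟨0, fun h => absurd h hB⟩
  choose P hP using hex
  refine ⟨P, ?_, hnear.mono fun B hB => ⟨(hP B hB).1, (hP B hB).2.1⟩, hnear.mono fun B hB => ?_⟩
  · refine tendsto_iff_norm_sub_tendsto_zero.2 ?_
    have hsq : Tendsto (fun B => √(8 * ‖A‖ * ‖B - A‖ / (s - t))) (𝓝 A) (𝓝 0) := by
      simpa using ((hlim.const_mul (8 * ‖A‖)).div_const (s - t)).sqrt
    refine squeeze_zero' (Eventually.of_forall fun _ => norm_nonneg _) ?_ hsq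
    filter_upwards [hnear] with B hB
    apply Real.le_sqrt_of_sq_le
    rw [le_div_iff₀ (sub_pos.2 hst), mul_comm]
    exact (hP B hB).2.2.1
  · obtain ⟨-, -, -, htr, hn, hu⟩ := hP B hB
    refine ⟨hn, hu, fun T => ⟨?_, fun hT => hT ▸ htr⟩⟩
    rintro ⟨n, ρ, u, v, hsvd, rfl⟩
    -- The truncation of any other SVD of `B` is also a nearest point, so uniqueness makes it
    -- independent of the decomposition.
    obtain ⟨P', -, -, -, h4, h5, -⟩ := h.truncated_of_near hr hs ht ht0 hst hB hsvd
    rw [h4]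
    exact hu _ h5

end FixedRank

theorem mainTheorem1 {l m r k : ℕ} (hr : 0 < r) (hk : 0 < k)
    (A : Matrix (Fin l) (Fin m) ℝ) (σ : Fin (r + k) → ℝ)
    (u : Fin (r + k) → Fin l → ℝ) (v : Fin (r + k) → Fin m → ℝ)
    (hA : FixedRank.IsSVD A σ u v)
    (hgap : σ ⟨r, by omega⟩ < σ ⟨r - 1, by omega⟩) :
    -- near `A` the projection onto the manifold is uniquely defined and is the truncated SVD
    (∀ᶠ B in 𝓝 A, (∃! R, FixedRank.IsNearest (FixedRank.fixedRank l m r) B R) ∧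
      ∀ T, FixedRank.IsTruncatedSVD r B T ↔
        T = FixedRank.orthProj (FixedRank.fixedRank l m r) B) ∧
    DifferentiableAt ℝ (FixedRank.orthProj (FixedRank.fixedRank l m r)) A ∧
    (∀ X : Matrix (Fin l) (Fin m) ℝ,
      fderiv ℝ (FixedRank.orthProj (FixedRank.fixedRank l m r)) A X =
        FixedRank.orthProj (FixedRank.tangentSpace (FixedRank.fixedRank l m r)
          (FixedRank.orthProj (FixedRank.fixedRank l m r) A)) X +
        ∑ i : Fin r, ∑ j : Fin k,
          ((σ (Fin.natAdd r j) / (σ (Fin.castAdd k i) - σ (Fin.natAdd r j)) *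
              FixedRank.frobInner X (FixedRank.phiPlus (u (Fin.castAdd k i)) (u (Fin.natAdd r j))
                (v (Fin.castAdd k i)) (v (Fin.natAdd r j)))) •
            FixedRank.phiPlus (u (Fin.castAdd k i)) (u (Fin.natAdd r j))
              (v (Fin.castAdd k i)) (v (Fin.natAdd r j)) -
           (σ (Fin.natAdd r j) / (σ (Fin.castAdd k i) + σ (Fin.natAdd r j)) *
              FixedRank.frobInner X (FixedRank.phiMinus (u (Fin.castAdd k i)) (u (Fin.natAdd r j))
                (v (Fin.castAdd k i)) (v (Fin.natAdd r j)))) •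
            FixedRank.phiMinus (u (Fin.castAdd k i)) (u (Fin.natAdd r j))
              (v (Fin.castAdd k i)) (v (Fin.natAdd r j)))) ∧
    (∀ (U : Matrix (Fin l) (Fin r) ℝ) (Z : Matrix (Fin m) (Fin r) ℝ),
      Uᵀ * U = 1 → Z.rank = r →
      FixedRank.orthProj (FixedRank.fixedRank l m r) A = U * Zᵀ →
      ∀ X : Matrix (Fin l) (Fin m) ℝ,
        fderiv ℝ (FixedRank.orthProj (FixedRank.fixedRank l m r)) A X =
          (1 - U * Uᵀ) * X * Z * (Zᵀ * Z)⁻¹ * Zᵀ + U * Uᵀ * X +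
          ∑ i : Fin r, ∑ j : Fin k,
            (σ (Fin.natAdd r j) / (σ (Fin.castAdd k i) ^ 2 - σ (Fin.natAdd r j) ^ 2)) •
              ((σ (Fin.natAdd r j) * (u (Fin.natAdd r j) ⬝ᵥ X *ᵥ v (Fin.castAdd k i)) +
                  σ (Fin.castAdd k i) * (u (Fin.castAdd k i) ⬝ᵥ X *ᵥ v (Fin.natAdd r j))) •
                vecMulVec (u (Fin.natAdd r j)) (v (Fin.castAdd k i)) +
               (σ (Fin.castAdd k i) * (u (Fin.natAdd r j) ⬝ᵥ X *ᵥ v (Fin.castAdd k i)) +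
                  σ (Fin.natAdd r j) * (u (Fin.castAdd k i) ⬝ᵥ X *ᵥ v (Fin.natAdd r j))) •
                vecMulVec (u (Fin.castAdd k i)) (v (Fin.natAdd r j)))) := by
  have hb := hA.blockSVD
  obtain ⟨s, t, ht0, hst, hs, ht⟩ := hA.exists_gap hr fun _ => hgap
  have hσ : ∀ i : Fin r, σ (Fin.castAdd k i) ≠ 0 := fun i => (hA.pos _).ne'
  have hlt : ∀ (i : Fin r) (j : Fin k), σ (Fin.natAdd r j) < σ (Fin.castAdd k i) := fun i j =>
    lt_of_pow_lt_pow_left₀ 2 (hA.pos _).le ((ht j).trans_lt (hst.trans_le (hs i)))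
  have hgap' : ∀ (i : Fin r) (j : Fin k),
      σ (Fin.castAdd k i) ^ 2 - σ (Fin.natAdd r j) ^ 2 ≠ 0 := fun i j =>
    (sub_pos.2 (((ht j).trans_lt (hst.trans_le (hs i))))).ne'
  obtain ⟨P, hlim, hP, hnear⟩ := hb.exists_proj_family hr hs ht ht0 hst
  obtain ⟨hn, hu⟩ := hb.isNearest hσ hs ht ht0 hst
  have hprojA := FixedRank.orthProj_eq hn hu
  have hproj : ∀ᶠ B in 𝓝 A,
      FixedRank.orthProj (FixedRank.fixedRank l m r) B = P B * B := by
    filter_upwards [hnear] with B hB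
    exact FixedRank.orthProj_eq hB.1 hB.2.1
  have hderiv := hb.hasFDerivAt_truncation hσ hgap' hP hlim hproj hprojA
  have hfd : ∀ X, fderiv ℝ (FixedRank.orthProj (FixedRank.fixedRank l m r)) A X = _ := fun X =>
    (congrArg (fun L => L X) hderiv.fderiv).trans (FixedRank.truncationDeriv_apply _ _ _ _ _ _ X)
  refine ⟨?_, hderiv.differentiableAt, fun X => ?_, fun Y Z hY hZ hYZ X => ?_⟩
  · filter_upwards [hnear, hproj] with B hB hB'
    exact ⟨⟨_, hB.1, hB.2.1⟩, fun T => by rw [hB']; exact hB.2.2 T⟩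
  · rw [hfd X, hprojA, hb.orthProj_tangentSpace hr (ht0.trans_lt hst) hs]
    congr 1
    refine Finset.sum_congr rfl fun i _ => Finset.sum_congr rfl fun j _ => ?_
    exact (FixedRank.phi_terms_eq (sub_pos.2 (hlt i j)).ne'
      (add_pos (hA.pos _) (hA.pos _)).ne' X _ _ _ _).symm
  · obtain ⟨h1, h2⟩ := hb.proj_eq_of_factorization hσ hY hZ (hprojA ▸ hYZ)
    rw [hfd X, ← h1, ← h2]
    simp only [Matrix.mul_assoc]
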